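/- Let $r\ge 2$ and let $\Gamma_1,\dots,\Gamma_r$ be nontrivial groups with finite symmetric generating sets $S_1,\dots,S_r$, where the case $r=2=|\Gamma_1|=|\Gamma_2|$ is excluded. Let $\Gamma=\Gamma_1*\dots*\Gamma_r$ be the free product with identity $e$, let $\mathcal X$ be its Cayley graph with respect to $\bigcup_i S_i$, and let $l(x)$ be the graph distance from $e$ to $x$ in $\mathcal X$. A ray is an infinite path in $\mathcal X$ that starts at $e$ and has no repeated vertices. Two rays are equivalent if some third ray shares infinitely many vertices with each of them, and $\Omega$ is the set of equivalence classes (ends). Let $\Omega_\infty\subseteq\Omega$ be the set of ends described by infinite words $x_1x_2x_3\dots$ whose letters are non-trivial elements of the factors, consecutive letters lying in different factors; that is, the ends having a representative that passes through $x_1\cdots x_n$ for every $n\ge 0$. Fix $\alpha\in(0,1)$. For ends $\omega_1\ne\omega_2$ let $c(\omega_1,\omega_2)$ be the maximal $m\in\mathbb N_0$ such that $\omega_1,\omega_2$ end up in the same connected component of $\mathcal X\setminus\{x: l(x)\le m-1\}$. Equip $\Omega$ with the metric $d_\Omega(\omega_1,\omega_2)=\alpha^{c(\omega_1,\omega_2)}$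 for $\omega_1\neq\omega_2$ and $d_\Omega(\omega,\omega)=0$, and write $B(\omega,\varepsilon)=\{\omega' : d_\Omega(\omega,\omega')\le\varepsilon\}$. A cover of $\Omega'\subseteq\Omega$ is a finite or countable family of balls $B(\omega,\varepsilon_\omega)$ with $\omega\in\Omega'$ and $\varepsilon_\omega>0$ whose union contains $\Omega'$. Let $N_\varepsilon(\Omega')$ be the minimal number of balls in a cover of $\Omega'$ all of whose radii are at most $\varepsilon$. The box-counting dimension is $$\mathrm{BD}(\Omega')=\lim_{\varepsilon\downarrow0}\frac{\log N_\varepsilon(\Omega')}{-\log\varepsilon},$$ if the limit exists, and the Hausdorff dimension is $$\mathrm{HD}(\Omega')=\inf\{\delta\ge0:\mathcal H_\delta(\Omega')=0\},\qquad \mathcal H_\delta(\Omega')=\lim_{\varepsilon\downarrow0}\inf\Bigl\{\sum_i\varepsilon_i^\delta\Bigr\},$$ the inner infimum being over all covers of $\Omega'$ by balls of radii $\varepsilon_i<\varepsilon$. For $i\in\{1,\dots,r\}$ let $\mathcal S_i^+(z)=\sum_{m\ge1}|\{x\in\Gamma_i: l(x)=m\}|\,z^m$. Then there is a smallest real number $z^*_{\mathcal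 S}>0$ at which all the series $\mathcal S_i^+$ converge and $$\sum_{i=1}^r\frac{\mathcal S_i^+(z^*_{\mathcal S})}{1+\mathcal S_i^+(z^*_{\mathcal S})}=1,$$ the box-counting dimensions of $\Omega$ and $\Omega_\infty$ exist, and $$\mathrm{BD}(\Omega)=\mathrm{BD}(\Omega_\infty)=\mathrm{HD}(\Omega)=\mathrm{HD}(\Omega_\infty)=\frac{\log z^*_{\mathcal S}}{\log\alpha}.$$ -/

import Mathlib

open Filter Topology
open scoped ENNReal NNReal

noncomputable section

/-! ### Ends of a rooted graph -/

section Ends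

variable {V : Type*}

/-- A ray from the root `o`: a semi-infinite path `[o = x₀, x₁, x₂, …]` without repetitions. -/
structure RootedRay (X : SimpleGraph V) (o : V) where
  /-- the vertices of the ray -/
  vertex : ℕ → V
  vertex_zero : vertex 0 = o
  adj_succ : ∀ n, X.Adj (vertex n) (vertex (n + 1))
  injective : Function.Injective vertex

/-- Two rays are equivalent if some third ray shares infinitely many vertices with each of them. -/
def RayEquiv {X : SimpleGraph V} {o : V} (r₁ r₂ : RootedRay X o) : Prop :=
  ∃ r₃ : RootedRay X o,
    (Set.range r₃.vertex ∩ Set.range r₁.vertex).Infinite ∧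
    (Set.range r₃.vertex ∩ Set.range r₂.vertex).Infinite

/-- The space of ends: equivalence classes of rays. -/
def EndSpace (X : SimpleGraph V) (o : V) : Type _ :=
  Quot (RayEquiv (X := X) (o := o))

/-- The end represented by a ray. -/
def RootedRay.toEnd {X : SimpleGraph V} {o : V} (r : RootedRay X o) : EndSpace X o :=
  Quot.mk RayEquiv r

/-- An end is contained in a set of vertices if each of its representatives has all but finitely
many of its vertices in that set. -/
def EndSpace.ContainedIn {X : SimpleGraph V} {o : V} (ω : EndSpace X o) (A : Set V) : Prop :=
  ∀ r : RootedRay X o, r.toEnd = ω → ∀ᶠ n in atTop, r.vertex n ∈ A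

/-- The vertices at graph distance less than `m` from the root, i.e. the ball `B_{m-1}`
(so that `m = 0` gives the empty set). -/
def ballBelow (X : SimpleGraph V) (o : V) (m : ℕ) : Set V :=
  {x | X.dist o x < m}

/-- Both ends end up in the same connected component of `X ∖ B_{m-1}`. -/
def SameComponent {X : SimpleGraph V} {o : V} (m : ℕ) (ω₁ ω₂ : EndSpace X o) : Prop :=
  ∃ C : X.ComponentCompl (ballBelow X o m),
    ω₁.ContainedIn (C : Set V) ∧ ω₂.ContainedIn (C : Set V)

/-- `c(ω₁, ω₂)`: the maximal `m` such that both ends end up in the same component of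
`X ∖ B_{m-1}`. For distinct ends of a connected locally finite graph this is a natural number;
for `ω₁ = ω₂` every `m` qualifies and the value is `⊤`. -/
def confluence {X : SimpleGraph V} {o : V} (ω₁ ω₂ : EndSpace X o) : ℕ∞ :=
  ⨆ (m : ℕ) (_ : SameComponent m ω₁ ω₂), (m : ℕ∞)

open Classical in
/-- The metric `α ^ c(ω₁, ω₂)` on the space of ends, where `α ^ ⊤ = 0`, i.e. the distance of an
end to itself is `0`. -/
def endDist {X : SimpleGraph V} {o : V} (α : ℝ) (ω₁ ω₂ : EndSpace X o) : ℝ :=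
  if confluence ω₁ ω₂ = ⊤ then 0 else α ^ (confluence ω₁ ω₂).toNat

end Ends

/-! ### Box-counting and Hausdorff dimension with respect to a distance function -/

section Dimension

variable {E : Type*}

/-- A family of balls, recorded as pairs (centre, radius), is a cover of `A` if it is finite or
countable, the centres are in `A`, the radii are positive and the closed balls
`{ω' | d ω ω' ≤ ε}` cover `A`. -/
def IsBallCover (d : E → E → ℝ) (A : Set E) (C : Set (E × ℝ)) : Prop :=
  C.Countable ∧ (∀ p ∈ C, p.1 ∈ A ∧ 0 < p.2) ∧ ∀ ω ∈ A, ∃ p ∈ C, d p.1 ω ≤ p.2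

/-- `N_ε(A)`: the minimal number of balls with radii at most `ε` in a cover of `A`. -/
def coverNumber (d : E → E → ℝ) (A : Set E) (ε : ℝ) : ℕ∞ :=
  ⨅ (C : Set (E × ℝ)) (_ : IsBallCover d A C ∧ ∀ p ∈ C, p.2 ≤ ε), C.encard

/-- `log N_ε(A) / (- log ε)`. -/
def boxRatio (d : E → E → ℝ) (A : Set E) (ε : ℝ) : EReal :=
  ENNReal.log (coverNumber d A ε : ℝ≥0∞) / ((-Real.log ε : ℝ) : EReal)

/-- The lower box-counting dimension. -/
def lowerBoxDim (d : E → E → ℝ) (A : Set E) : EReal :=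
  liminf (boxRatio d A) (𝓝[>] (0 : ℝ))

/-- The upper box-counting dimension. -/
def upperBoxDim (d : E → E → ℝ) (A : Set E) : EReal :=
  limsup (boxRatio d A) (𝓝[>] (0 : ℝ))

/-- The box-counting dimension of `A` exists and equals `s`. -/
def HasBoxDim (d : E → E → ℝ) (A : Set E) (s : EReal) : Prop :=
  lowerBoxDim d A = s ∧ upperBoxDim d A = s

/-- The infimum of `∑ εᵢ ^ δ` over all covers of `A` by balls of radii `εᵢ < ε`. -/
def hausdorffContent (d : E → E → ℝ) (A : Set E) (δ ε : ℝ) : ℝ≥0∞ :=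
  ⨅ (C : Set (E × ℝ)) (_ : IsBallCover d A C ∧ ∀ p ∈ C, p.2 < ε),
    ∑' p : C, ENNReal.ofReal ((p : E × ℝ).2 ^ δ)

/-- The `δ`-dimensional Hausdorff measure: the limit of the above as `ε ↓ 0`, which is the
supremum over `ε > 0` because the infimum is monotone in `ε`. -/
def hausdorffMeas (d : E → E → ℝ) (A : Set E) (δ : ℝ) : ℝ≥0∞ :=
  ⨆ (ε : ℝ) (_ : 0 < ε), hausdorffContent d A δ ε

/-- The Hausdorff dimension `inf {δ ≥ 0 | H_δ(A) = 0}`. -/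
def hausdorffDim (d : E → E → ℝ) (A : Set E) : EReal :=
  ⨅ (δ : ℝ) (_ : 0 ≤ δ ∧ hausdorffMeas d A δ = 0), (δ : EReal)

end Dimension

/-! ### Free products of groups -/

section FreeProduct

variable {ι : Type*} {G : ι → Type*} [∀ i, Group (G i)]

/-- The Cayley graph of the free product of the `G i` with respect to the union of the generating
sets `S i` of the factors. -/
def freeProductGraph (S : ∀ i, Set (G i)) : SimpleGraph (Monoid.CoprodI G) :=
  SimpleGraph.mulCayley (⋃ i, (Monoid.CoprodI.of : G i →* Monoid.CoprodI G) '' S i)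

/-- The length `l(x)`: the graph distance of `x` to the identity. -/
def freeProductLength (S : ∀ i, Set (G i)) (x : Monoid.CoprodI G) : ℕ :=
  (freeProductGraph S).dist 1 x

/-- The end boundary `Ω` of the free product. -/
abbrev FreeProductEnds (S : ∀ i, Set (G i)) : Type _ :=
  EndSpace (freeProductGraph S) 1

/-- An infinite word `x₁x₂x₃…`: nontrivial letters, consecutive ones from different factors. -/
def IsInfiniteWord (x : ℕ → Σ i, G i) : Prop :=
  ∀ n, (x n).2 ≠ 1 ∧ (x n).1 ≠ (x (n + 1)).1

/-- The prefix of length `n` of an infinite word, as an element of the free product. -/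
def wordPrefix (x : ℕ → Σ i, G i) (n : ℕ) : Monoid.CoprodI G :=
  ((List.range n).map fun k => Monoid.CoprodI.of (x k).2).prod

/-- The set `Ω_∞` of ends described by infinite words: ends that have a representative ray passing
through all prefixes of some infinite word. -/
def infiniteWordEnds (S : ∀ i, Set (G i)) : Set (FreeProductEnds S) :=
  {ω | ∃ x : ℕ → Σ i, G i, IsInfiniteWord x ∧
    ∃ r : RootedRay (freeProductGraph S) 1,
      r.toEnd = ω ∧ ∀ n, wordPrefix x n ∈ Set.range r.vertex}

/-- `S_i(m)`: the number of elements of the `i`-th factor of length `m`. -/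
def sphereCount (S : ∀ i, Set (G i)) (i : ι) (m : ℕ) : ℕ :=
  {x : G i | freeProductLength S (Monoid.CoprodI.of x) = m}.ncard

/-- The terms `S_i(m) z ^ m`, `m ≥ 1`, of the sphere-counting series of the `i`-th factor. -/
def sphereTerm (S : ∀ i, Set (G i)) (i : ι) (z : ℝ) (m : ℕ) : ℝ :=
  (sphereCount S i (m + 1) : ℝ) * z ^ (m + 1)

/-- `S_i⁺(z) = ∑_{m ≥ 1} S_i(m) z ^ m`. -/
def sphereSeries (S : ∀ i, Set (G i)) (i : ι) (z : ℝ) : ℝ :=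
  ∑' m : ℕ, sphereTerm S i z m

/-- The positive reals at which all series `S_i⁺` converge and `∑ S_i⁺ / (1 + S_i⁺) = 1`. -/
def sphereRoots [Fintype ι] (S : ∀ i, Set (G i)) : Set ℝ :=
  {z | 0 < z ∧ (∀ i, Summable (sphereTerm S i z)) ∧
    ∑ i, sphereSeries S i z / (1 + sphereSeries S i z) = 1}

end FreeProduct

end

/-!
Give each letter `g` of `Γ_i` the weight `z ^ l(g)`, and a reduced word the product of the weights
of its letters times `1 - S_i⁺(z) / (1 + S_i⁺(z))`, where `i` is the factor of its last letter. With
`F(z) = ∑ i, S_i⁺(z) / (1 + S_i⁺(z))`, the weights of the one-letter extensions of a word add up to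
the weight of the word minus `1 - F(z)` times the product of its letters. For `z = α ^ δ` this gives
both bounds:

* If `F(z) < 1`, the products of all words have a finite sum, so spheres of radius `m` have
  `O(z ^ (-m))` elements. Every end meets each sphere, so `Ω` is covered by that many balls of
  radius comparable to `α ^ m`, and its box dimension is at most `δ`.
* If `F(z) ≥ 1`, already for a finite set of letters, then the weight of a word is at most the sum
  of the weights of its extensions. A ball around an end of `Ω_∞` is contained in the set of ends
  below a prefix of its word, so a cover of `Ω_∞` gives a family of words that meets all infinite
  words, and `∑ ε_i ^ δ` is at least a positive constant.

The smallest root of `F = 1` exists because the sphere sizes of a factor are submultiplicative: if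
`S_i⁺` converges at `z`, it converges beyond `z`, so `F` cannot jump from below `1` to infinity.
-/

/-! ### Bounds for dimensions -/

section DimensionBounds

variable {E : Type*} {d : E → E → ℝ} {A : Set E}

theorem coverNumber_le_encard {C : Set (E × ℝ)} {ε : ℝ} (hC : IsBallCover d A C)
    (hε : ∀ p ∈ C, p.2 ≤ ε) : coverNumber d A ε ≤ C.encard :=
  iInf₂_le C ⟨hC, hε⟩

theorem exists_isBallCover_encard_eq_coverNumber {ε : ℝ} (h : coverNumber d A ε ≠ ⊤) :
    ∃ C, IsBallCover d A C ∧ (∀ p ∈ C, p.2 ≤ ε) ∧ C.encard = coverNumber d A ε := by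
  rw [coverNumber, iInf_subtype'] at h ⊢
  have : Nonempty {C : Set (E × ℝ) // IsBallCover d A C ∧ ∀ p ∈ C, p.2 ≤ ε} := by
    by_contra hempty
    rw [not_nonempty_iff] at hempty
    exact h (iInf_of_empty _)
  obtain ⟨⟨C, hC, hCε⟩, hCeq⟩ := ciInf_mem fun C : {C : Set (E × ℝ) //
    IsBallCover d A C ∧ ∀ p ∈ C, p.2 ≤ ε} => C.1.encard
  exact ⟨C, hC, hCε, hCeq⟩

theorem coverNumber_antitone : Antitone (coverNumber d A) := fun _ _ h =>
  le_iInf₂ fun _ hC => coverNumber_le_encard hC.1 fun p hp => (hC.2 p hp).trans h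

theorem hausdorffContent_le_coverNumber_mul {δ ε η : ℝ} (hδ : 0 ≤ δ) (hη : 0 < η) (hηε : η < ε) :
    hausdorffContent d A δ ε ≤ coverNumber d A η * ENNReal.ofReal (η ^ δ) := by
  by_cases htop : coverNumber d A η = ⊤
  · have : ENNReal.ofReal (η ^ δ) ≠ 0 := by simpa using Real.rpow_pos_of_pos hη δ
    simp [htop, ENNReal.top_mul this]
  obtain ⟨C, hC, hCη, hCcard⟩ := exists_isBallCover_encard_eq_coverNumber htop
  calc hausdorffContent d A δ ε
      ≤ ∑' p : C, ENNReal.ofReal ((p : E × ℝ).2 ^ δ) :=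
        iInf₂_le C ⟨hC, fun p hp => (hCη p hp).trans_lt hηε⟩
    _ ≤ ∑' _ : C, ENNReal.ofReal (η ^ δ) := ENNReal.tsum_le_tsum fun p =>
        ENNReal.ofReal_le_ofReal (Real.rpow_le_rpow (hC.2.1 p p.2).2.le (hCη p p.2) hδ)
    _ = coverNumber d A η * ENNReal.ofReal (η ^ δ) := by
        rw [ENNReal.tsum_const, ← hCcard, Set.encard]

theorem hausdorffContent_antitone_exponent {ε : ℝ} (hε : ε ≤ 1) :
    Antitone fun δ => hausdorffContent d A δ ε := fun _ _ h =>
  le_iInf₂ fun C hC => (iInf₂_le C hC).trans <| ENNReal.tsum_le_tsum fun p =>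
    ENNReal.ofReal_le_ofReal <| Real.rpow_le_rpow_of_exponent_ge (hC.1.2.1 p p.2).2
      ((hC.2 p p.2).le.trans hε) h

theorem eventually_mem_Ioo_nhdsGT_zero : ∀ᶠ ε : ℝ in 𝓝[>] 0, ε ∈ Set.Ioo (0 : ℝ) 1 :=
  Ioo_mem_nhdsGT one_pos

theorem tendsto_log_mul_rpow_div_neg_log {c : ℝ} (hc : 0 < c) (δ : ℝ) :
    Tendsto (fun ε : ℝ =>
      ENNReal.log (ENNReal.ofReal (c * ε ^ (-δ))) / ((-Real.log ε : ℝ) : EReal))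
      (𝓝[>] 0) (𝓝 (δ : EReal)) := by
  have hlog : Tendsto (fun ε : ℝ => -Real.log ε) (𝓝[>] 0) atTop :=
    tendsto_neg_atBot_atTop.comp Real.tendsto_log_nhdsGT_zero
  have hreal : Tendsto (fun ε : ℝ => Real.log c / (-Real.log ε) + δ) (𝓝[>] 0) (𝓝 δ) := by
    simpa only [zero_add] using (hlog.const_div_atTop (Real.log c)).add_const δ
  refine ((continuous_coe_real_ereal.tendsto δ).comp hreal).congr' ?_
  filter_upwards [eventually_mem_Ioo_nhdsGT_zero] with ε hε
  have hpos : 0 < ε ^ (-δ) := Real.rpow_pos_of_pos hε.1 _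
  have hlog0 : Real.log ε ≠ 0 := (Real.log_neg hε.1 hε.2).ne
  rw [ENNReal.log_ofReal_of_pos (by positivity), Real.log_mul hc.ne' hpos.ne',
    Real.log_rpow hε.1, ← EReal.coe_div, Function.comp_apply]
  congr 1
  field_simp
  ring

theorem log_div_neg_log_mono {ε : ℝ} (hε : ε ∈ Set.Ioo (0 : ℝ) 1) {a b : ℝ≥0∞} (hab : a ≤ b) :
    ENNReal.log a / ((-Real.log ε : ℝ) : EReal) ≤ ENNReal.log b / ((-Real.log ε : ℝ) : EReal) :=
  EReal.div_le_div_right_of_nonneg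
    (by exact_mod_cast (neg_pos.2 (Real.log_neg hε.1 hε.2)).le) (ENNReal.log_monotone hab)

theorem upperBoxDim_le_of_coverNumber_le {K δ : ℝ} (hK : 0 < K)
    (h : ∀ ε ∈ Set.Ioo (0 : ℝ) 1,
      (coverNumber d A ε : ℝ≥0∞) ≤ ENNReal.ofReal (K * ε ^ (-δ))) :
    upperBoxDim d A ≤ δ := by
  rw [← (tendsto_log_mul_rpow_div_neg_log hK δ).limsup_eq]
  refine limsup_le_limsup ?_
  filter_upwards [eventually_mem_Ioo_nhdsGT_zero] with ε hε
  exact log_div_neg_log_mono hε (h ε hε)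

theorem hausdorffMeas_eq_zero_of_coverNumber_le {K δ δ' : ℝ}
    (h : ∀ ε ∈ Set.Ioo (0 : ℝ) 1,
      (coverNumber d A ε : ℝ≥0∞) ≤ ENNReal.ofReal (K * ε ^ (-δ)))
    (hδδ' : δ < δ') (hδ' : 0 ≤ δ') : hausdorffMeas d A δ' = 0 := by
  simp only [hausdorffMeas, ENNReal.iSup_eq_zero]
  intro ε hε
  have hlim : Tendsto (fun η : ℝ => ENNReal.ofReal (K * η ^ (δ' - δ))) (𝓝[>] 0) (𝓝 0) := by
    have hpow := (Real.continuousAt_rpow_const 0 (δ' - δ) (Or.inr (by linarith))).tendsto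
    rw [Real.zero_rpow (by linarith)] at hpow
    simpa only [mul_zero, ENNReal.ofReal_zero] using
      ENNReal.tendsto_ofReal ((hpow.mono_left nhdsWithin_le_nhds).const_mul K)
  refine nonpos_iff_eq_zero.1 (ge_of_tendsto hlim ?_)
  filter_upwards [eventually_mem_Ioo_nhdsGT_zero, Ioo_mem_nhdsGT hε] with η hη hηε
  calc hausdorffContent d A δ' ε
      ≤ coverNumber d A η * ENNReal.ofReal (η ^ δ') :=
        hausdorffContent_le_coverNumber_mul hδ' hη.1 hηε.2
    _ ≤ ENNReal.ofReal (K * η ^ (-δ)) * ENNReal.ofReal (η ^ δ') := by gcongr; exact h η hη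
    _ = ENNReal.ofReal (K * η ^ (δ' - δ)) := by
        rw [← ENNReal.ofReal_mul' (Real.rpow_nonneg hη.1.le _), mul_assoc, ← Real.rpow_add hη.1,
          neg_add_eq_sub]

theorem hausdorffDim_le_of_coverNumber_le {K δ : ℝ} (hδ : 0 ≤ δ)
    (h : ∀ ε ∈ Set.Ioo (0 : ℝ) 1,
      (coverNumber d A ε : ℝ≥0∞) ≤ ENNReal.ofReal (K * ε ^ (-δ))) :
    hausdorffDim d A ≤ δ := by
  refine EReal.le_of_forall_lt_iff_le.1 fun δ' hδ' => ?_
  have hlt : δ < δ' := by exact_mod_cast hδ'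
  have hδ'0 : 0 ≤ δ' := hδ.trans hlt.le
  exact iInf₂_le δ' ⟨hδ'0, hausdorffMeas_eq_zero_of_coverNumber_le h hlt hδ'0⟩

theorem le_lowerBoxDim_of_le_hausdorffContent {c δ : ℝ} (hc : 0 < c) (hδ : 0 ≤ δ)
    (h : ENNReal.ofReal c ≤ hausdorffContent d A δ 1) : (δ : EReal) ≤ lowerBoxDim d A := by
  rw [← (tendsto_log_mul_rpow_div_neg_log hc δ).liminf_eq]
  refine liminf_le_liminf ?_
  filter_upwards [eventually_mem_Ioo_nhdsGT_zero] with ε hε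
  refine log_div_neg_log_mono hε ?_
  have hpos : 0 < ε ^ (-δ) := Real.rpow_pos_of_pos hε.1 _
  calc ENNReal.ofReal (c * ε ^ (-δ))
      = ENNReal.ofReal c * ENNReal.ofReal (ε ^ (-δ)) := ENNReal.ofReal_mul hc.le
    _ ≤ coverNumber d A ε * ENNReal.ofReal (ε ^ δ) * ENNReal.ofReal (ε ^ (-δ)) := by
        gcongr
        exact h.trans (hausdorffContent_le_coverNumber_mul hδ hε.1 hε.2)
    _ = coverNumber d A ε := by
        rw [mul_assoc, ← ENNReal.ofReal_mul' hpos.le, ← Real.rpow_add hε.1, add_neg_cancel,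
          Real.rpow_zero, ENNReal.ofReal_one, mul_one]

theorem le_hausdorffDim_of_le_hausdorffContent {c δ : ℝ} (hc : 0 < c)
    (h : ENNReal.ofReal c ≤ hausdorffContent d A δ 1) : (δ : EReal) ≤ hausdorffDim d A := by
  refine le_iInf₂ fun δ' ⟨_, hzero⟩ => EReal.coe_le_coe_iff.2 (le_of_not_gt fun hlt => ?_)
  have hmeas : ENNReal.ofReal c ≤ hausdorffMeas d A δ' :=
    (h.trans (hausdorffContent_antitone_exponent le_rfl hlt.le)).trans
      (le_iSup₂ (f := fun ε (_ : 0 < ε) => hausdorffContent d A δ' ε) 1 one_pos)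
  rw [hzero, nonpos_iff_eq_zero, ENNReal.ofReal_eq_zero] at hmeas
  exact hc.not_ge hmeas

theorem lowerBoxDim_le_upperBoxDim : lowerBoxDim d A ≤ upperBoxDim d A :=
  liminf_le_limsup

theorem hasBoxDim_and_hausdorffDim_eq_of_bounds {D : ℝ} (hD : 0 ≤ D)
    (hcover : ∀ δ : ℝ, D < δ → ∃ K : ℝ, 0 < K ∧ ∀ ε ∈ Set.Ioo (0 : ℝ) 1,
      (coverNumber d A ε : ℝ≥0∞) ≤ ENNReal.ofReal (K * ε ^ (-δ)))
    (hcontent : ∀ δ : ℝ, 0 ≤ δ → (δ = 0 ∨ δ < D) →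
      ∃ c : ℝ, 0 < c ∧ ENNReal.ofReal c ≤ hausdorffContent d A δ 1) :
    HasBoxDim d A D ∧ hausdorffDim d A = D := by
  have hle : upperBoxDim d A ≤ D ∧ hausdorffDim d A ≤ D := by
    constructor <;> refine EReal.le_of_forall_lt_iff_le.1 fun δ hδ => ?_ <;>
      obtain ⟨K, hK, h⟩ := hcover δ (EReal.coe_lt_coe_iff.1 hδ)
    · exact upperBoxDim_le_of_coverNumber_le hK h
    · exact hausdorffDim_le_of_coverNumber_le (hD.trans (EReal.coe_lt_coe_iff.1 hδ).le) h
  have hge : D ≤ lowerBoxDim d A ∧ D ≤ hausdorffDim d A := by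
    have hmax : ∀ δ : ℝ, (δ : EReal) < D → max δ 0 = 0 ∨ max δ 0 < D := fun δ hδ =>
      (max_choice δ 0).symm.imp_right fun h => h.trans_lt (EReal.coe_lt_coe_iff.1 hδ)
    constructor <;> refine EReal.ge_of_forall_gt_iff_ge.1 fun δ hδ => ?_ <;>
      obtain ⟨c, hc, h⟩ := hcontent _ (le_max_right δ 0) (hmax δ hδ) <;>
      refine (EReal.coe_le_coe_iff.2 (le_max_left δ 0)).trans ?_
    · exact le_lowerBoxDim_of_le_hausdorffContent hc (le_max_right δ 0) h
    · exact le_hausdorffDim_of_le_hausdorffContent hc h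
  exact ⟨⟨(lowerBoxDim_le_upperBoxDim.trans hle.1).antisymm hge.1,
    hle.1.antisymm (hge.1.trans lowerBoxDim_le_upperBoxDim)⟩, hle.2.antisymm hge.2⟩

end DimensionBounds

/-! ### The equation `∑ x i / (1 + x i) = 1` for power series `x i` -/

section PowerSeries

variable {ι : Type*} {a : ι → ℕ → ℝ} {y z : ℝ}

/-- The values at `z` of the power series `∑ m, a i m * z ^ (m + 1)` without constant term. -/
noncomputable def seriesSum (a : ι → ℕ → ℝ) (z : ℝ) (i : ι) : ℝ :=
  ∑' m, a i m * z ^ (m + 1)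

/-- The values at `z` of the first `n` terms of the power series of `seriesSum`. -/
noncomputable def partialSum (a : ι → ℕ → ℝ) (n : ℕ) (z : ℝ) (i : ι) : ℝ :=
  ∑ m ∈ Finset.range n, a i m * z ^ (m + 1)

theorem term_nonneg (ha : 0 ≤ a) (hz : 0 ≤ z) (i : ι) (m : ℕ) : 0 ≤ a i m * z ^ (m + 1) :=
  mul_nonneg (ha i m) (pow_nonneg hz _)

theorem partialSum_nonneg (ha : 0 ≤ a) (hz : 0 ≤ z) (n : ℕ) : 0 ≤ partialSum a n z := fun i =>
  Finset.sum_nonneg fun m _ => term_nonneg ha hz i m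

theorem seriesSum_nonneg (ha : 0 ≤ a) (hz : 0 ≤ z) : 0 ≤ seriesSum a z := fun i =>
  tsum_nonneg fun m => term_nonneg ha hz i m

theorem partialSum_le_seriesSum (ha : 0 ≤ a) (hz : 0 ≤ z)
    (hs : ∀ i, Summable fun m => a i m * z ^ (m + 1)) (n : ℕ) :
    partialSum a n z ≤ seriesSum a z := fun i =>
  (hs i).sum_le_tsum _ fun m _ => term_nonneg ha hz i m

theorem term_le_partialSum (ha : 0 ≤ a) (hz : 0 ≤ z) {m n : ℕ} (hmn : m < n) (i : ι) :
    a i m * z ^ (m + 1) ≤ partialSum a n z i :=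
  Finset.single_le_sum (f := fun m => a i m * z ^ (m + 1)) (fun m _ => term_nonneg ha hz i m)
    (Finset.mem_range.2 hmn)

theorem partialSum_mono_right (ha : 0 ≤ a) (hz : 0 ≤ z) (i : ι) :
    Monotone fun n => partialSum a n z i := fun _ _ hmn =>
  Finset.sum_le_sum_of_subset_of_nonneg (Finset.range_subset_range.2 hmn)
    fun m _ _ => term_nonneg ha hz i m

theorem summable_pow_of_le {c : ℕ → ℝ} (hc : 0 ≤ c) (hy : 0 ≤ y) (hyz : y ≤ z)
    (hs : Summable fun m => c m * z ^ (m + 1)) : Summable fun m => c m * y ^ (m + 1) :=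
  hs.of_nonneg_of_le (fun m => mul_nonneg (hc m) (pow_nonneg hy _))
    fun m => mul_le_mul_of_nonneg_left (pow_le_pow_left₀ hy hyz _) (hc m)

theorem seriesSum_lt_seriesSum (ha : 0 ≤ a) (hpos : ∀ i, ∃ m, 0 < a i m) (hy : 0 ≤ y)
    (hyz : y < z) (hs : ∀ i, Summable fun m => a i m * z ^ (m + 1)) (i : ι) :
    seriesSum a y i < seriesSum a z i := by
  obtain ⟨m, hm⟩ := hpos i
  exact Summable.tsum_lt_tsum (i := m)
    (fun m => mul_le_mul_of_nonneg_left (pow_le_pow_left₀ hy hyz.le _) (ha i m))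
    (mul_lt_mul_of_pos_left (pow_lt_pow_left₀ hyz hy m.succ_ne_zero) hm)
    (summable_pow_of_le (ha i) hy hyz.le (hs i)) (hs i)

theorem continuousOn_seriesSum (ha : 0 ≤ a) {i : ι}
    (hs : Summable fun m => a i m * z ^ (m + 1)) :
    ContinuousOn (fun y => seriesSum a y i) (Set.Icc 0 z) := by
  refine continuousOn_tsum (fun m => by fun_prop) hs fun m y hy => ?_
  rw [Real.norm_of_nonneg (term_nonneg ha hy.1 i m)]
  exact mul_le_mul_of_nonneg_left (pow_le_pow_left₀ hy.1 hy.2 _) (ha i m)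

theorem exists_forall_le_partialSum [Finite ι] (ha : 0 ≤ a) (hone : ∀ i, ∃ m, 1 ≤ a i m) :
    ∃ n, ∀ z, 1 ≤ z → ∀ i, z ≤ partialSum a n z i := by
  choose m hm using hone
  obtain ⟨n, hn⟩ := (Set.finite_range m).bddAbove
  refine ⟨n + 1, fun z hz i => ?_⟩
  calc z ≤ z ^ (m i + 1) := le_self_pow₀ hz (m i).succ_ne_zero
    _ ≤ a i (m i) * z ^ (m i + 1) := le_mul_of_one_le_left (by positivity) (hm i)
    _ ≤ partialSum a (n + 1) z i :=
        term_le_partialSum ha (by positivity) (Nat.lt_succ_of_le (hn ⟨i, rfl⟩)) i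

end PowerSeries

section RatioSum

variable {ι : Type*} [Fintype ι] {x y : ι → ℝ}

/-- The sum of the ratios `x i / (1 + x i)`, meant for `x ≥ 0`. The root equation of the theorem
says that this sum is `1` for `x i = S_i⁺(z)`. -/
noncomputable def ratioSum (x : ι → ℝ) : ℝ :=
  ∑ i, x i / (1 + x i)

theorem div_one_add_le_div_one_add {s t : ℝ} (hs : 0 ≤ s) (h : s ≤ t) :
    s / (1 + s) ≤ t / (1 + t) := by
  rw [div_le_div_iff₀ (by linarith) (by linarith)]
  linarith

theorem div_one_add_lt_div_one_add {s t : ℝ} (hs : 0 ≤ s) (h : s < t) :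
    s / (1 + s) < t / (1 + t) := by
  rw [div_lt_div_iff₀ (by linarith) (by linarith)]
  linarith

theorem ratioSum_mono (hx : 0 ≤ x) (hxy : x ≤ y) : ratioSum x ≤ ratioSum y :=
  Finset.sum_le_sum fun i _ => div_one_add_le_div_one_add (hx i) (hxy i)

theorem ratioSum_strictMono [Nonempty ι] (hx : 0 ≤ x) (hxy : ∀ i, x i < y i) :
    ratioSum x < ratioSum y :=
  Finset.sum_lt_sum_of_nonempty Finset.univ_nonempty fun i _ =>
    div_one_add_lt_div_one_add (hx i) (hxy i)

theorem tendsto_ratioSum {β : Type*} {l : Filter β} {f : β → ι → ℝ} (hx : 0 ≤ x)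
    (hf : ∀ i, Tendsto (fun b => f b i) l (𝓝 (x i))) :
    Tendsto (fun b => ratioSum (f b)) l (𝓝 (ratioSum x)) :=
  tendsto_finsetSum _ fun i _ =>
    (hf i).div (tendsto_const_nhds.add (hf i)) (add_pos_of_pos_of_nonneg one_pos (hx i)).ne'

theorem one_le_ratioSum_one [Nontrivial ι] : 1 ≤ ratioSum (1 : ι → ℝ) := by
  have hcard : (2 : ℝ) ≤ Fintype.card ι := by exact_mod_cast Fintype.one_lt_card (α := ι)
  have hsum : ratioSum (1 : ι → ℝ) = Fintype.card ι / 2 := by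
    norm_num [ratioSum, div_eq_mul_inv]
  linarith

theorem mul_le_one_of_ratioSum_le_one (hx : 0 ≤ x) (h : ratioSum x ≤ 1) {i j : ι} (hij : i ≠ j) :
    x i * x j ≤ 1 := by
  classical
  have hi : 0 ≤ x i := hx i
  have hj : 0 ≤ x j := hx j
  have hpair : x i / (1 + x i) + x j / (1 + x j) ≤ 1 := by
    rw [← Finset.sum_pair hij (f := fun k => x k / (1 + x k))]
    exact (Finset.sum_le_sum_of_subset_of_nonneg (Finset.subset_univ _) fun k _ _ =>
      div_nonneg (hx k) (add_nonneg zero_le_one (hx k))).trans h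
  rw [div_add_div _ _ (by positivity) (by positivity), div_le_one (by positivity)] at hpair
  linarith

variable {a : ι → ℕ → ℝ} {y z : ℝ}

/-- The `z ≥ 0` at which no partial sums of the series make the sum of ratios exceed `1`. Its
maximum is the smallest root of the equation `ratioSum (seriesSum a z) = 1`. -/
def subcriticalSet (a : ι → ℕ → ℝ) : Set ℝ :=
  {z | 0 ≤ z ∧ ∀ n, ratioSum (partialSum a n z) ≤ 1}

theorem isClosed_subcriticalSet (ha : 0 ≤ a) : IsClosed (subcriticalSet a) := by
  have hcont : ∀ n, ContinuousOn (fun z => ratioSum (partialSum a n z)) (Set.Ici 0) :=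
    fun n z hz => tendsto_ratioSum (partialSum_nonneg ha hz n) fun i =>
      (by unfold partialSum; fun_prop : Continuous fun z => partialSum a n z i).continuousWithinAt
  have : subcriticalSet a =
      Set.Ici 0 ∩ ⋂ n, Set.Ici 0 ∩ (fun z => ratioSum (partialSum a n z)) ⁻¹' Set.Iic 1 := by
    ext z
    simp only [subcriticalSet, Set.mem_ofPred_eq, Set.mem_inter_iff, Set.mem_Ici, Set.mem_iInter,
      Set.mem_preimage, Set.mem_Iic]
    exact ⟨fun h => ⟨h.1, fun n => ⟨h.1, h.2 n⟩⟩, fun h => ⟨h.1, fun n => (h.2 n).2⟩⟩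
  rw [this]
  exact isClosed_Ici.inter (isClosed_iInter fun n =>
    (hcont n).preimage_isClosed_of_isClosed isClosed_Ici isClosed_Iic)

theorem zero_mem_subcriticalSet : 0 ∈ subcriticalSet a :=
  ⟨le_rfl, fun n => by simp [ratioSum, partialSum]⟩

theorem mem_subcriticalSet_of_ratioSum_le_one (ha : 0 ≤ a) (hz : 0 ≤ z)
    (hs : ∀ i, Summable fun m => a i m * z ^ (m + 1)) (h : ratioSum (seriesSum a z) ≤ 1) :
    z ∈ subcriticalSet a :=
  ⟨hz, fun n => (ratioSum_mono (partialSum_nonneg ha hz n)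
    (partialSum_le_seriesSum ha hz hs n)).trans h⟩

theorem exists_one_le_ratioSum_partialSum_one [Nontrivial ι] (ha : 0 ≤ a)
    (hone : ∀ i, ∃ m, 1 ≤ a i m) : ∃ n, 1 ≤ ratioSum (partialSum a n 1) := by
  obtain ⟨n, hn⟩ := exists_forall_le_partialSum ha hone
  exact ⟨n, one_le_ratioSum_one.trans (ratioSum_mono zero_le_one (hn 1 le_rfl))⟩

theorem subcriticalSet_subset_Icc [Nontrivial ι] (ha : 0 ≤ a) (hone : ∀ i, ∃ m, 1 ≤ a i m) :
    subcriticalSet a ⊆ Set.Icc 0 1 := by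
  refine fun z hz => ⟨hz.1, le_of_not_gt fun hlt => ?_⟩
  obtain ⟨n, hn⟩ := exists_forall_le_partialSum ha hone
  have hlt' : ratioSum (1 : ι → ℝ) < ratioSum (partialSum a n z) :=
    ratioSum_strictMono zero_le_one fun i => hlt.trans_le (hn z hlt.le i)
  exact (one_le_ratioSum_one.trans_lt hlt').not_ge (hz.2 n)

theorem exists_isGreatest_subcriticalSet [Nontrivial ι] (ha : 0 ≤ a)
    (hone : ∀ i, ∃ m, 1 ≤ a i m) : ∃ z, IsGreatest (subcriticalSet a) z :=
  (isCompact_Icc.of_isClosed_subset (isClosed_subcriticalSet ha)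
    (subcriticalSet_subset_Icc ha hone)).exists_isGreatest ⟨0, zero_mem_subcriticalSet⟩

theorem summable_of_mem_subcriticalSet [Nontrivial ι] (ha : 0 ≤ a) (hpos : ∀ i, ∃ m, 0 < a i m)
    (hz : z ∈ subcriticalSet a) (i : ι) : Summable fun m => a i m * z ^ (m + 1) := by
  obtain ⟨hz0, hzle⟩ := hz
  rcases hz0.eq_or_lt with rfl | hzpos
  · simp [summable_zero]
  obtain ⟨j, hj⟩ := exists_ne i
  obtain ⟨m₀, hm₀⟩ := hpos j
  set e := a j m₀ * z ^ (m₀ + 1)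
  have he : 0 < e := by positivity
  refine summable_of_sum_range_le (c := 1 / e) (term_nonneg ha hz0 i) fun n => ?_
  have hN := partialSum_nonneg ha hz0 (max n (m₀ + 1))
  rw [le_div_iff₀ he]
  calc partialSum a n z i * e
      ≤ partialSum a (max n (m₀ + 1)) z i * partialSum a (max n (m₀ + 1)) z j :=
        mul_le_mul (partialSum_mono_right ha hz0 i (le_max_left _ _))
          (term_le_partialSum ha hz0 (Nat.lt_of_succ_le (le_max_right _ _)) j) he.le (hN i)
    _ ≤ 1 := mul_le_one_of_ratioSum_le_one hN (hzle _) hj.symm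

theorem ratioSum_seriesSum_le_one [Nontrivial ι] (ha : 0 ≤ a) (hpos : ∀ i, ∃ m, 0 < a i m)
    (hz : z ∈ subcriticalSet a) : ratioSum (seriesSum a z) ≤ 1 :=
  le_of_tendsto' (tendsto_ratioSum (seriesSum_nonneg ha hz.1) fun i =>
    (summable_of_mem_subcriticalSet ha hpos hz i).hasSum.tendsto_sum_nat) hz.2

theorem ratioSum_seriesSum_lt_one [Nontrivial ι] (ha : 0 ≤ a) (hpos : ∀ i, ∃ m, 0 < a i m)
    (hz : z ∈ subcriticalSet a) (hy : 0 ≤ y) (hyz : y < z) : ratioSum (seriesSum a y) < 1 :=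
  (ratioSum_strictMono (seriesSum_nonneg ha hy) (seriesSum_lt_seriesSum ha hpos hy hyz
    (summable_of_mem_subcriticalSet ha hpos hz))).trans_le (ratioSum_seriesSum_le_one ha hpos hz)

theorem exists_one_lt_ratioSum_partialSum (hz : IsGreatest (subcriticalSet a) z) (hzy : z < y) :
    ∃ n, 1 < ratioSum (partialSum a n y) := by
  by_contra! hle
  exact (hz.2 ⟨hz.1.1.trans hzy.le, hle⟩).not_gt hzy

theorem ratioSum_seriesSum_eq_one [Nontrivial ι] (ha : 0 ≤ a) (hpos : ∀ i, ∃ m, 0 < a i m)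
    (hext : ∀ i, ∀ z : ℝ, 0 ≤ z → (Summable fun m => a i m * z ^ (m + 1)) →
      ∃ y, z < y ∧ Summable fun m => a i m * y ^ (m + 1))
    (hz : IsGreatest (subcriticalSet a) z) : ratioSum (seriesSum a z) = 1 := by
  have hz0 : 0 ≤ z := hz.1.1
  refine (ratioSum_seriesSum_le_one ha hpos hz.1).eq_of_not_lt fun hlt => ?_
  obtain ⟨y, hzy, hsum⟩ : ∃ y, z < y ∧ ∀ i, Summable fun m => a i m * y ^ (m + 1) := by
    choose y hy hys using fun i => hext i z hz0 (summable_of_mem_subcriticalSet ha hpos hz.1 i)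
    obtain ⟨i₀, hi₀⟩ := Finite.exists_min y
    exact ⟨y i₀, hy i₀, fun i =>
      summable_pow_of_le (ha i) (hz0.trans (hy i₀).le) (hi₀ i) (hys i)⟩
  have hlim : Tendsto (fun x => ratioSum (seriesSum a x)) (𝓝[>] z) (𝓝 (ratioSum (seriesSum a z))) :=
    tendsto_ratioSum (seriesSum_nonneg ha hz0) fun i =>
      ((continuousOn_seriesSum ha (hsum i)) z ⟨hz0, hzy.le⟩).mono_of_mem_nhdsWithin
        (mem_of_superset (Ioo_mem_nhdsGT hzy) fun x hx => ⟨hz0.trans hx.1.le, hx.2.le⟩)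
  obtain ⟨x, hx1, hzx, hxy⟩ := ((hlim.eventually_lt_const hlt).and (Ioo_mem_nhdsGT hzy)).exists
  have hx0 : 0 ≤ x := hz0.trans hzx.le
  exact (hz.2 (mem_subcriticalSet_of_ratioSum_le_one ha hx0
    (fun i => summable_pow_of_le (ha i) hx0 hxy.le (hsum i)) hx1.le)).not_gt hzx

end RatioSum

/-! ### Power series with submultiplicative coefficients -/

section Submultiplicative

theorem summable_of_submultiplicative {b : ℕ → ℝ} (hb : 0 ≤ b)
    (hsub : ∀ m n, b (m + n) ≤ b m * b n) {n : ℕ} (hn : n ≠ 0) (hlt : b n < 1) : Summable b := by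
  have : NeZero n := ⟨hn⟩
  have hpow : ∀ q r, b (q * n + r) ≤ b n ^ q * b r := by
    intro q r
    induction q with
    | zero => simp
    | succ q ih =>
      calc b ((q + 1) * n + r) = b (n + (q * n + r)) := by congr 1; ring
        _ ≤ b n * b (q * n + r) := hsub _ _
        _ ≤ b n * (b n ^ q * b r) := mul_le_mul_of_nonneg_left ih (hb n)
        _ = b n ^ (q + 1) * b r := by ring
  have hprod : Summable fun p : ℕ × Fin n => b n ^ p.1 * b p.2 :=
    (summable_geometric_of_lt_one (hb n) hlt).mul_of_nonneg
      (Summable.of_finite (f := fun r : Fin n => b r)) (fun q => pow_nonneg (hb n) q)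
      fun r => hb r
  rw [← (Nat.divModEquiv n).symm.summable_iff]
  refine hprod.of_nonneg_of_le (fun p => hb _) fun p => ?_
  simpa [Nat.divModEquiv] using hpow p.1 p.2

theorem exists_gt_summable_of_submultiplicative {c : ℕ → ℝ} (hc : 0 ≤ c)
    (hsub : ∀ m n, c (m + n) ≤ c m * c n) {z : ℝ} (hz : 0 ≤ z)
    (hs : Summable fun m => c (m + 1) * z ^ (m + 1)) :
    ∃ y, z < y ∧ Summable fun m => c (m + 1) * y ^ (m + 1) := by
  obtain ⟨m, hm⟩ := (hs.tendsto_atTop_zero.eventually_lt_const one_pos).exists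
  have hcont : Continuous fun y : ℝ => c (m + 1) * y ^ (m + 1) := by fun_prop
  obtain ⟨y, hym, hzy⟩ : ∃ y, c (m + 1) * y ^ (m + 1) < 1 ∧ z < y :=
    ((hcont.continuousAt.eventually_lt_const hm).filter_mono nhdsWithin_le_nhds |>.and
      (self_mem_nhdsWithin (s := Set.Ioi z))).exists
  have hy : 0 ≤ y := hz.trans hzy.le
  refine ⟨y, hzy, (summable_nat_add_iff 1 (f := fun m => c m * y ^ m)).2 ?_⟩
  refine summable_of_submultiplicative (fun k => mul_nonneg (hc k) (pow_nonneg hy k))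
    (fun k l => ?_) m.succ_ne_zero hym
  calc c (k + l) * y ^ (k + l) ≤ (c k * c l) * y ^ (k + l) :=
        mul_le_mul_of_nonneg_right (hsub k l) (pow_nonneg hy _)
    _ = c k * y ^ k * (c l * y ^ l) := by rw [pow_add]; ring

end Submultiplicative

/-! ### Distances in graphs -/

section GraphDistance

variable {V W : Type*} {X : SimpleGraph V} {Y : SimpleGraph W}

theorem le_add_dist_of_lipschitz (hX : X.Connected) {f : V → ℕ}
    (hf : ∀ u v, X.Adj u v → f v ≤ f u + 1) (u v : V) : f v ≤ f u + X.dist u v := by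
  obtain ⟨p, hp⟩ := hX.exists_walk_length_eq_dist u v
  rw [← hp]
  clear hp
  induction p with
  | nil => simp
  | cons h p ih =>
    have := hf _ _ h
    rw [SimpleGraph.Walk.length_cons]
    omega

theorem dist_map_le_dist (hX : X.Connected) (hY : Y.Connected) {f : V → W}
    (hf : ∀ u v, X.Adj u v → Y.dist (f u) (f v) ≤ 1) (u v : V) :
    Y.dist (f u) (f v) ≤ X.dist u v := by
  have h := le_add_dist_of_lipschitz (f := fun w => Y.dist (f u) (f w)) hX
    (fun w w' h => hY.dist_triangle.trans (Nat.add_le_add_left (hf w w' h) _)) u v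
  rwa [SimpleGraph.dist_self, zero_add] at h

theorem exists_dist_eq_dist_eq (hX : X.Connected) {u v : V} {m n : ℕ} (h : X.dist u v = m + n) :
    ∃ w, X.dist u w = m ∧ X.dist w v = n := by
  obtain ⟨p, hp⟩ := hX.exists_walk_length_eq_dist u v
  have htake : X.dist u (p.getVert m) ≤ m :=
    (SimpleGraph.dist_le (p.take m)).trans (by simp)
  have hdrop : X.dist (p.getVert m) v ≤ n :=
    (SimpleGraph.dist_le (p.drop m)).trans (by simp [hp, h])
  have htri := hX.dist_triangle (u := u) (v := p.getVert m) (w := v)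
  exact ⟨p.getVert m, by omega, by omega⟩

end GraphDistance

/-! ### Reduced words in free products -/

section ReducedWords

open Monoid

variable {ι : Type*} {G : ι → Type*} [∀ i, Group (G i)]

/-- A list of letters is reduced if all letters are nontrivial and consecutive letters lie in
different factors. -/
def IsReducedWord (L : List (Σ i, G i)) : Prop :=
  (∀ a ∈ L, a.2 ≠ 1) ∧ L.IsChain fun a b => a.1 ≠ b.1

/-- The element of the free product represented by a list of letters. -/
def listProd (L : List (Σ i, G i)) : CoprodI G :=
  (L.map fun a => CoprodI.of a.2).prod

open Classical in
/-- The reduced word of an element of the free product. -/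
noncomputable def reducedWord (x : CoprodI G) : List (Σ i, G i) :=
  (CoprodI.Word.equiv x).toList

/-- The word with the single letter `g`, or the empty word if `g = 1`. -/
noncomputable def letterWord (i : ι) (g : G i) : List (Σ i, G i) :=
  open Classical in if g = 1 then [] else [⟨i, g⟩]

@[simp]
theorem listProd_nil : listProd ([] : List (Σ i, G i)) = 1 := rfl

@[simp]
theorem listProd_cons (a : Σ i, G i) (L : List (Σ i, G i)) :
    listProd (a :: L) = CoprodI.of a.2 * listProd L := rfl

@[simp]
theorem listProd_append (L M : List (Σ i, G i)) :
    listProd (L ++ M) = listProd L * listProd M := by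
  simp [listProd]

@[simp]
theorem listProd_letterWord (i : ι) (g : G i) : listProd (letterWord i g) = CoprodI.of g := by
  unfold letterWord
  split_ifs with h <;> simp [h]

theorem isReduced_reducedWord (x : CoprodI G) : IsReducedWord (reducedWord x) := by
  classical
  exact ⟨(CoprodI.Word.equiv x).ne_one, (CoprodI.Word.equiv x).chain_ne⟩

@[simp]
theorem listProd_reducedWord (x : CoprodI G) : listProd (reducedWord x) = x := by
  classical
  exact CoprodI.Word.equiv.symm_apply_apply x

theorem reducedWord_injective : Function.Injective (reducedWord (G := G)) := fun x y h => by
  rw [← listProd_reducedWord x, h, listProd_reducedWord]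

theorem reducedWord_listProd {L : List (Σ i, G i)} (hL : IsReducedWord L) :
    reducedWord (listProd L) = L := by
  classical
  exact congrArg CoprodI.Word.toList
    (CoprodI.Word.equiv.apply_symm_apply (⟨L, hL.1, hL.2⟩ : CoprodI.Word G))

theorem IsReducedWord.of_append_left {L M : List (Σ i, G i)} (h : IsReducedWord (L ++ M)) :
    IsReducedWord L :=
  ⟨fun a ha => h.1 a (List.mem_append_left _ ha), h.2.left_of_append⟩

theorem IsReducedWord.append_letterWord {P : List (Σ i, G i)} (hP : IsReducedWord P) {i : ι}
    (hi : ∀ a ∈ P.getLast?, a.1 ≠ i) (g : G i) : IsReducedWord (P ++ letterWord i g) := by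
  unfold letterWord
  split_ifs with h
  · simpa using hP
  · refine ⟨fun a ha => ?_, hP.2.append (List.isChain_singleton _) ?_⟩
    · rcases List.mem_append.1 ha with ha | ha
      · exact hP.1 a ha
      · rw [List.mem_singleton.1 ha]
        exact h
    · intro a ha b hb
      simp only [List.head?_cons, Option.mem_def, Option.some.injEq] at hb
      rw [← hb]
      exact hi a ha

theorem IsReducedWord.exists_eq_append_letterWord {L : List (Σ i, G i)} (hL : IsReducedWord L)
    (i : ι) :
    ∃ (P : List (Σ i, G i)) (g : G i), L = P ++ letterWord i g ∧ ∀ a ∈ P.getLast?, a.1 ≠ i := by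
  rcases List.eq_nil_or_concat L with rfl | ⟨P, ⟨j, g⟩, rfl⟩
  · exact ⟨[], 1, by simp [letterWord], by simp⟩
  · by_cases hij : j = i
    · subst hij
      have hg : g ≠ 1 := hL.1 ⟨j, g⟩ (by simp)
      refine ⟨P, g, by simp [letterWord, hg], fun a ha => ?_⟩
      have := hL.2
      rw [List.concat_eq_append, List.isChain_append] at this
      exact this.2.2 a ha ⟨j, g⟩ (by simp)
    · exact ⟨P.concat ⟨j, g⟩, 1, by simp [letterWord], by simpa using hij⟩

theorem exists_reducedWord_mul_of (x : CoprodI G) (i : ι) (s : G i) :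
    ∃ P g, reducedWord x = P ++ letterWord i g ∧
      reducedWord (x * CoprodI.of s) = P ++ letterWord i (g * s) := by
  obtain ⟨P, g, hx, hP⟩ := (isReduced_reducedWord x).exists_eq_append_letterWord i
  have hPr : IsReducedWord P := (hx ▸ isReduced_reducedWord x).of_append_left
  refine ⟨P, g, hx, ?_⟩
  rw [← reducedWord_listProd (hPr.append_letterWord hP (g * s))]
  congr 1
  rw [← listProd_reducedWord x, hx]
  simp [mul_assoc]

theorem eq_of_prefix_of_not_prefix {x : CoprodI G} {i : ι} {s : G i} {w : List (Σ i, G i)}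
    (hx : w <+: reducedWord x) (hxs : ¬ w <+: reducedWord (x * CoprodI.of s)) :
    w = reducedWord x := by
  obtain ⟨P, g, h1, h2⟩ := exists_reducedWord_mul_of x i s
  rw [h1] at hx ⊢
  rw [h2] at hxs
  have hP : ¬ w <+: P := fun h => hxs (h.trans (List.prefix_append _ _))
  unfold letterWord at hx ⊢
  split_ifs at hx ⊢ with hg
  · simp only [List.append_nil] at hx
    exact absurd hx hP
  · rw [List.prefix_concat_iff] at hx
    rcases hx with hx | hx
    · exact hx
    · exact absurd hx hP

end ReducedWords

/-! ### Lengths in free products -/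

section FreeProductLength

open Monoid

variable {ι : Type*} {G : ι → Type*} [∀ i, Group (G i)] {S : ∀ i, Set (G i)}

theorem freeProductGraph_adj_iff {u v : CoprodI G} :
    (freeProductGraph S).Adj u v ↔
      u ≠ v ∧ ∃ i, ∃ s, (s ∈ S i ∨ s⁻¹ ∈ S i) ∧ v = u * CoprodI.of s := by
  rw [freeProductGraph, SimpleGraph.mulCayley_adj]
  simp only [Set.mem_iUnion, Set.mem_image]
  refine and_congr_right fun _ => ⟨?_, ?_⟩
  · rintro (⟨i, s, hs, h⟩ | ⟨i, s, hs, h⟩)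
    · exact ⟨i, s, Or.inl hs, by rw [h]; group⟩
    · exact ⟨i, s⁻¹, Or.inr (by rwa [inv_inv]), by rw [map_inv, h]; group⟩
  · rintro ⟨i, s, hs | hs, rfl⟩
    · exact Or.inl ⟨i, s, hs, by group⟩
    · exact Or.inr ⟨i, s⁻¹, hs, by rw [map_inv]; group⟩

theorem freeProductGraph_adj_mul_left (a : CoprodI G) {u v : CoprodI G}
    (h : (freeProductGraph S).Adj u v) : (freeProductGraph S).Adj (a * u) (a * v) :=
  SimpleGraph.mulCayley_adj_mul_iff_right.2 h

theorem freeProductGraph_reachable_mul_left (a : CoprodI G) {u v : CoprodI G}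
    (h : (freeProductGraph S).Reachable u v) : (freeProductGraph S).Reachable (a * u) (a * v) :=
  h.map ⟨(a * ·), freeProductGraph_adj_mul_left a⟩

theorem freeProductGraph_reachable_one_of (hgen : ∀ i, Subgroup.closure (S i) = ⊤) {i : ι}
    (g : G i) : (freeProductGraph S).Reachable 1 (CoprodI.of g) := by
  have hg : g ∈ Subgroup.closure (S i) := hgen i ▸ Subgroup.mem_top g
  induction hg using Subgroup.closure_induction with
  | mem s hs =>
    by_cases h : (1 : CoprodI G) = CoprodI.of s
    · rw [← h]
    · exact (freeProductGraph_adj_iff.2 ⟨h, i, s, Or.inl hs, (one_mul _).symm⟩).reachable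
  | one => rw [map_one]
  | mul g h _ _ hg hh =>
    have hgh := freeProductGraph_reachable_mul_left (CoprodI.of g) hh
    rw [mul_one, ← map_mul] at hgh
    exact hg.trans hgh
  | inv g _ hg =>
    have h := freeProductGraph_reachable_mul_left (CoprodI.of g)⁻¹ hg
    rw [mul_one, inv_mul_cancel, ← map_inv] at h
    exact h.symm

theorem freeProductGraph_connected (hgen : ∀ i, Subgroup.closure (S i) = ⊤) :
    (freeProductGraph S).Connected := by
  have hreach : ∀ x : CoprodI G, (freeProductGraph S).Reachable 1 x := fun x => by
    induction x using CoprodI.induction_on with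
    | one => exact SimpleGraph.Reachable.refl _
    | of i g => exact freeProductGraph_reachable_one_of hgen g
    | mul x y hx hy =>
      have hxy := freeProductGraph_reachable_mul_left x hy
      rw [mul_one] at hxy
      exact hx.trans hxy
  have : Nonempty (CoprodI G) := ⟨1⟩
  exact ⟨fun u v => (hreach u).symm.trans (hreach v)⟩

theorem freeProductGraph_dist_mul_left (hgen : ∀ i, Subgroup.closure (S i) = ⊤)
    (a u v : CoprodI G) :
    (freeProductGraph S).dist (a * u) (a * v) = (freeProductGraph S).dist u v := by
  have hX := freeProductGraph_connected hgen
  have hle : ∀ a u v : CoprodI G,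
      (freeProductGraph S).dist (a * u) (a * v) ≤ (freeProductGraph S).dist u v := fun a =>
    dist_map_le_dist hX hX fun _ _ h =>
      (SimpleGraph.dist_eq_one_iff_adj.2 (freeProductGraph_adj_mul_left a h)).le
  refine le_antisymm (hle a u v) ?_
  simpa only [inv_mul_cancel_left] using hle a⁻¹ (a * u) (a * v)

theorem freeProductLength_inv_mul (hgen : ∀ i, Subgroup.closure (S i) = ⊤) (u v : CoprodI G) :
    freeProductLength S (u⁻¹ * v) = (freeProductGraph S).dist u v := by
  rw [freeProductLength, ← freeProductGraph_dist_mul_left hgen u, mul_one, mul_inv_cancel_left]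

theorem freeProductLength_mul_le (hgen : ∀ i, Subgroup.closure (S i) = ⊤) (u v : CoprodI G) :
    freeProductLength S (u * v) ≤ freeProductLength S u + freeProductLength S v := by
  have h := (freeProductGraph_connected hgen).dist_triangle (u := 1) (v := u) (w := u * v)
  rwa [← freeProductLength_inv_mul hgen u, inv_mul_cancel_left] at h

@[simp]
theorem freeProductLength_one : freeProductLength S 1 = 0 := SimpleGraph.dist_self

theorem freeProductLength_eq_zero (hgen : ∀ i, Subgroup.closure (S i) = ⊤) {x : CoprodI G} :
    freeProductLength S x = 0 ↔ x = 1 := by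
  rw [freeProductLength, (freeProductGraph_connected hgen).dist_eq_zero_iff, eq_comm]

theorem freeProductLength_of_le_one {i : ι} {s : G i} (hs : s ∈ S i ∨ s⁻¹ ∈ S i) :
    freeProductLength S (CoprodI.of s) ≤ 1 := by
  by_cases h : (1 : CoprodI G) = CoprodI.of s
  · simp [← h]
  · exact (SimpleGraph.dist_eq_one_iff_adj.2
      (freeProductGraph_adj_iff.2 ⟨h, i, s, hs, (one_mul _).symm⟩)).le

/-- The length of a letter as an element of the free product. -/
noncomputable def letterLength (S : ∀ i, Set (G i)) (a : Σ i, G i) : ℕ :=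
  freeProductLength S (CoprodI.of a.2)

theorem letterLength_pos (hgen : ∀ i, Subgroup.closure (S i) = ⊤) {a : Σ i, G i}
    (ha : a.2 ≠ 1) : 0 < letterLength S a := by
  rwa [Nat.pos_iff_ne_zero, letterLength, ne_eq, freeProductLength_eq_zero hgen,
    map_eq_one_iff _ (CoprodI.of_injective a.1)]

/-- The sum of the lengths of the letters of a word. For reduced words this is the length of the
element represented by the word, see `freeProductLength_listProd`. -/
noncomputable def listLength (S : ∀ i, Set (G i)) (L : List (Σ i, G i)) : ℕ :=
  (L.map (letterLength S)).sum

@[simp]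
theorem listLength_append (L M : List (Σ i, G i)) :
    listLength S (L ++ M) = listLength S L + listLength S M := by
  rw [listLength, List.map_append, List.sum_append, listLength, listLength]

@[simp]
theorem listLength_letterWord (i : ι) (g : G i) :
    listLength S (letterWord i g) = freeProductLength S (CoprodI.of g) := by
  unfold letterWord
  split_ifs with h <;> simp [h, listLength, letterLength]

theorem freeProductLength_listProd_le (hgen : ∀ i, Subgroup.closure (S i) = ⊤)
    (L : List (Σ i, G i)) : freeProductLength S (listProd L) ≤ listLength S L := by
  induction L with
  | nil => simp
  | cons a L ih =>
    calc freeProductLength S (listProd (a :: L))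
        ≤ letterLength S a + freeProductLength S (listProd L) := freeProductLength_mul_le hgen _ _
      _ ≤ letterLength S a + listLength S L := Nat.add_le_add_left ih _
      _ = listLength S (a :: L) := by rw [listLength, listLength, List.map_cons, List.sum_cons]

theorem listLength_reducedWord (hgen : ∀ i, Subgroup.closure (S i) = ⊤) (x : CoprodI G) :
    listLength S (reducedWord x) = freeProductLength S x := by
  refine le_antisymm ?_ ?_
  · have hlip : ∀ u v, (freeProductGraph S).Adj u v →
        listLength S (reducedWord v) ≤ listLength S (reducedWord u) + 1 := by
      intro u v huv
      obtain ⟨-, i, s, hs, rfl⟩ := freeProductGraph_adj_iff.1 huv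
      obtain ⟨P, g, hu, hus⟩ := exists_reducedWord_mul_of u i s
      have hmul := freeProductLength_mul_le hgen (CoprodI.of g) (CoprodI.of s)
      have hs1 := freeProductLength_of_le_one (S := S) hs
      simp only [hu, hus, listLength_append, listLength_letterWord, map_mul]
      omega
    have hone : listLength S (reducedWord (1 : CoprodI G)) = 0 :=
      congrArg (listLength S) (reducedWord_listProd (L := []) ⟨by simp, List.isChain_nil⟩)
    have h := le_add_dist_of_lipschitz (freeProductGraph_connected hgen) hlip 1 x
    rwa [hone, zero_add] at h
  · simpa only [listProd_reducedWord] using freeProductLength_listProd_le hgen (reducedWord x)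

theorem freeProductLength_listProd (hgen : ∀ i, Subgroup.closure (S i) = ⊤)
    {L : List (Σ i, G i)} (hL : IsReducedWord L) :
    freeProductLength S (listProd L) = listLength S L := by
  rw [← listLength_reducedWord hgen, reducedWord_listProd hL]

theorem finite_freeProductLength_le [Finite ι] (hfinite : ∀ i, (S i).Finite)
    (hgen : ∀ i, Subgroup.closure (S i) = ⊤) (m : ℕ) :
    {x : CoprodI G | freeProductLength S x ≤ m}.Finite := by
  induction m with
  | zero =>
    refine (Set.finite_singleton 1).subset fun x hx => ?_
    exact (freeProductLength_eq_zero hgen).1 (Nat.le_zero.1 hx)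
  | succ m ih =>
    have hT : (⋃ i, (CoprodI.of : G i →* CoprodI G) '' (S i ∪ Inv.inv '' S i)).Finite :=
      Set.finite_iUnion fun i => ((hfinite i).union ((hfinite i).image _)).image _
    refine (ih.union (ih.image2 (· * ·) hT)).subset fun x hx => ?_
    rcases Nat.lt_or_ge m (freeProductLength S x) with h | h
    · obtain ⟨y, hy, hyx⟩ := exists_dist_eq_dist_eq (freeProductGraph_connected hgen)
        (hx.antisymm h : freeProductLength S x = m + 1)
      obtain ⟨-, i, s, hs, rfl⟩ :=
        freeProductGraph_adj_iff.1 (SimpleGraph.dist_eq_one_iff_adj.1 hyx)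
      have hs' : s ∈ S i ∪ Inv.inv '' S i := hs.imp_right fun h => ⟨s⁻¹, h, inv_inv s⟩
      exact Or.inr ⟨y, hy.le, CoprodI.of s, Set.mem_iUnion.2 ⟨i, s, hs', rfl⟩, rfl⟩
    · exact Or.inl h

theorem finite_letterLength_le [Finite ι] (hfinite : ∀ i, (S i).Finite)
    (hgen : ∀ i, Subgroup.closure (S i) = ⊤) (i : ι) (m : ℕ) :
    {g : G i | letterLength S ⟨i, g⟩ ≤ m}.Finite :=
  (finite_freeProductLength_le hfinite hgen m).preimage (CoprodI.of_injective i).injOn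

theorem exists_retraction_dist_le (hgen : ∀ i, Subgroup.closure (S i) = ⊤) (i : ι) :
    ∃ π : CoprodI G →* G i, (∀ g, π (CoprodI.of g) = g) ∧ ∀ u v,
      (freeProductGraph S).dist (CoprodI.of (π u)) (CoprodI.of (π v))
        ≤ (freeProductGraph S).dist u v := by
  classical
  have hX := freeProductGraph_connected hgen
  let π : CoprodI G →* G i := CoprodI.lift (Pi.mulSingle i (MonoidHom.id (G i)))
  refine ⟨π, CoprodI.of_leftInverse i, dist_map_le_dist hX hX fun u v huv => ?_⟩
  obtain ⟨-, j, s, hs, rfl⟩ := freeProductGraph_adj_iff.1 huv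
  rw [← freeProductLength_inv_mul hgen, map_mul, map_mul, inv_mul_cancel_left]
  by_cases hij : j = i
  · subst hij
    rw [show π (CoprodI.of s) = s from CoprodI.of_leftInverse j s]
    exact freeProductLength_of_le_one hs
  · have : π (CoprodI.of s) = 1 := by
      simp [π, CoprodI.lift_of, Pi.mulSingle_eq_of_ne hij]
    simp [this]

theorem sphereCount_add_le [Finite ι] (hfinite : ∀ i, (S i).Finite)
    (hgen : ∀ i, Subgroup.closure (S i) = ⊤) (i : ι) (m n : ℕ) :
    sphereCount S i (m + n) ≤ sphereCount S i m * sphereCount S i n := by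
  obtain ⟨π, hπ, hlip⟩ := exists_retraction_dist_le hgen i
  have hX := freeProductGraph_connected hgen
  have hfin : ∀ k, {x : G i | freeProductLength S (CoprodI.of x) = k}.Finite := fun k =>
    (finite_letterLength_le hfinite hgen i k).subset fun x hx => le_of_eq hx
  unfold sphereCount
  rw [← Set.ncard_prod]
  refine (Set.ncard_le_ncard (fun x hx => ?_) (((hfin m).prod (hfin n)).image
    fun p => p.1 * p.2)).trans (Set.ncard_image_le ((hfin m).prod (hfin n)))
  have hx' : (freeProductGraph S).dist 1 (CoprodI.of x) = m + n := hx
  obtain ⟨y, hy, hyx⟩ := exists_dist_eq_dist_eq hX hx'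
  have hleft := hlip 1 y
  have hright := hlip y (CoprodI.of x)
  rw [map_one, map_one] at hleft
  rw [hπ] at hright
  have htri := hX.dist_triangle (u := 1) (v := CoprodI.of (π y)) (w := CoprodI.of x)
  refine ⟨(π y, (π y)⁻¹ * x), ⟨?_, ?_⟩, mul_inv_cancel_left _ _⟩
  · change (freeProductGraph S).dist 1 (CoprodI.of (π y)) = m
    omega
  · change freeProductLength S (CoprodI.of ((π y)⁻¹ * x)) = n
    rw [map_mul, map_inv, freeProductLength_inv_mul hgen]
    omega

end FreeProductLength

/-! ### Words in a tree -/

section Branches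

variable {α : Type*}

/-- The first `n` letters of a sequence of letters. -/
def firstLetters (x : ℕ → α) (n : ℕ) : List α :=
  (List.range n).map x

theorem firstLetters_succ (x : ℕ → α) (n : ℕ) :
    firstLetters x (n + 1) = firstLetters x n ++ [x n] := by
  simp [firstLetters, List.range_succ]

@[simp]
theorem length_firstLetters (x : ℕ → α) (n : ℕ) : (firstLetters x n).length = n := by
  simp [firstLetters]

theorem firstLetters_prefix (x : ℕ → α) {m n : ℕ} (h : m ≤ n) :
    firstLetters x m <+: firstLetters x n := by
  induction n, h using Nat.le_induction with
  | base => exact List.prefix_rfl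
  | succ n _ ih =>
    rw [firstLetters_succ]
    exact ih.trans (List.prefix_append _ _)

theorem exists_forall_firstLetters {Q : List α → Prop} {A : List α → Finset α} (hnil : Q [])
    (hstep : ∀ v, Q v → ∃ a ∈ A v, Q (v ++ [a])) :
    ∃ x : ℕ → α, ∀ n, x n ∈ A (firstLetters x n) ∧ Q (firstLetters x n) := by
  choose a ha hQ using hstep
  let f : ℕ → {v // Q v} := Nat.rec ⟨[], hnil⟩ fun _ v => ⟨v.1 ++ [a v.1 v.2], hQ v.1 v.2⟩
  let x : ℕ → α := fun n => a (f n).1 (f n).2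
  have hf : ∀ n, firstLetters x n = (f n).1 := by
    intro n
    induction n with
    | zero => rfl
    | succ n ih => rw [firstLetters_succ, ih]
  exact ⟨x, fun n => ⟨hf n ▸ ha _ _, hf n ▸ (f n).2⟩⟩

theorem sum_ite_append_prefix_le [DecidableEq α] (v w : List α) (A : Finset α) (c : ℝ≥0∞) :
    ∑ a ∈ A, (if v ++ [a] <+: w then c else 0) ≤ if v <+: w then c else 0 := by
  by_cases h : ∃ a, v ++ [a] <+: w
  · obtain ⟨a, s, rfl⟩ := h
    have hiff : ∀ b, v ++ [b] <+: v ++ [a] ++ s ↔ b = a := by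
      simp [List.prefix_append_right_inj]
    rw [if_pos ⟨[a] ++ s, by simp⟩]
    simp only [hiff, Finset.sum_ite_eq']
    split_ifs <;> simp
  · push Not at h
    simp [h]

theorem le_tsum_of_forall_exists_eq_firstLetters {A : List α → Finset α} {W : List α → ℝ≥0∞}
    (hW : ∀ v, W v ≤ ∑ a ∈ A v, W (v ++ [a])) {J : Type*} (w : J → List α)
    (hw : ∀ x : ℕ → α, (∀ n, x n ∈ A (firstLetters x n)) → ∃ p n, w p = firstLetters x n) :
    W [] ≤ ∑' p, W (w p) := by
  classical
  let weightBelow : List α → ℝ≥0∞ := fun v => ∑' p, if v <+: w p then W (w p) else 0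
  have hsum : ∀ v, ∑ a ∈ A v, weightBelow (v ++ [a]) ≤ weightBelow v := fun v => by
    rw [← Summable.tsum_finsetSum fun _ _ => ENNReal.summable]
    exact ENNReal.tsum_le_tsum fun p => sum_ite_append_prefix_le _ _ _ _
  have hself : ∀ p, W (w p) ≤ weightBelow (w p) := fun p =>
    (if_pos List.prefix_rfl).ge.trans (ENNReal.le_tsum p)
  have hroot : weightBelow [] = ∑' p, W (w p) := by simp [weightBelow]
  by_contra! hlt
  obtain ⟨x, hx⟩ := exists_forall_firstLetters (Q := fun v => weightBelow v < W v) (A := A)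
    (hroot ▸ hlt) fun v hv => Finset.exists_lt_of_sum_lt ((hsum v).trans_lt (hv.trans_le (hW v)))
  obtain ⟨p, n, hp⟩ := hw x fun n => (hx n).1
  exact (hp ▸ (hx n).2).not_ge (hself p)

end Branches

/-! ### Weights of words -/

section WordWeight

variable {ι : Type*} {β : ι → Type*}

/-- The ratio `E i / (1 + E i)` of the factor `i` of the last letter of `v`, or `0` if `v` is
empty. -/
noncomputable def lastRatio (E : ι → ℝ) (v : List (Σ i, β i)) : ℝ :=
  v.getLast?.elim 0 fun a => E a.1 / (1 + E a.1)

/-- The generating polynomials of finite alphabets `B i` with weights `u`. -/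
def alphabetSum (u : (Σ i, β i) → ℝ) (B : ∀ i, Finset (β i)) (i : ι) : ℝ :=
  ∑ g ∈ B i, u ⟨i, g⟩

/-- The product of the weights `u` of the letters of `v`, discounted by the last letter in such a
way that passing to the words with one more letter nearly preserves the total weight, see
`sum_wordWeight_append`. -/
noncomputable def wordWeight (u : (Σ i, β i) → ℝ) (B : ∀ i, Finset (β i))
    (v : List (Σ i, β i)) : ℝ :=
  (v.map u).prod * (1 - lastRatio (alphabetSum u B) v)

variable {u : (Σ i, β i) → ℝ} {B : ∀ i, Finset (β i)}

theorem alphabetSum_nonneg (hu : 0 ≤ u) : 0 ≤ alphabetSum u B := fun _ =>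
  Finset.sum_nonneg fun _ _ => hu _

theorem prod_map_nonneg (hu : 0 ≤ u) (v : List (Σ i, β i)) : 0 ≤ (v.map u).prod :=
  List.prod_nonneg (List.forall_mem_map.2 fun a _ => hu a)

theorem lastRatio_mem_Icc {E : ι → ℝ} (hE : 0 ≤ E) (v : List (Σ i, β i)) :
    lastRatio E v ∈ Set.Icc 0 1 := by
  unfold lastRatio
  cases v.getLast? with
  | none => simp
  | some a =>
    have ha : 0 ≤ E a.1 := hE a.1
    exact ⟨by simp only [Option.elim_some]; positivity,
      div_le_one_of_le₀ (by linarith) (by linarith)⟩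

theorem wordWeight_nonneg (hu : 0 ≤ u) (v : List (Σ i, β i)) : 0 ≤ wordWeight u B v :=
  mul_nonneg (prod_map_nonneg hu v)
    (sub_nonneg.2 (lastRatio_mem_Icc (alphabetSum_nonneg hu) v).2)

theorem wordWeight_le_prod (hu : 0 ≤ u) (v : List (Σ i, β i)) :
    wordWeight u B v ≤ (v.map u).prod :=
  mul_le_of_le_one_right (prod_map_nonneg hu v)
    (sub_le_self _ (lastRatio_mem_Icc (alphabetSum_nonneg hu) v).1)

theorem wordWeight_append (hu : 0 ≤ u) (v : List (Σ i, β i)) (a : Σ i, β i) :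
    wordWeight u B (v ++ [a]) = (v.map u).prod * (u a / (1 + alphabetSum u B a.1)) := by
  have hE : 0 ≤ alphabetSum u B a.1 := alphabetSum_nonneg hu a.1
  simp only [wordWeight, lastRatio, List.map_append, List.map_singleton, List.prod_append,
    List.prod_singleton, List.getLast?_append, List.getLast?_singleton, Option.some_or,
    Option.elim_some]
  field_simp
  ring

variable [Fintype ι]

open Classical in
/-- The letters over the alphabets `B i` that may follow the word `v`: those in a different factor
than the last letter of `v`. -/
noncomputable def nextLetters (B : ∀ i, Finset (β i)) (v : List (Σ i, β i)) : Finset (Σ i, β i) :=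
  (Finset.univ.filter fun i => ∀ b ∈ v.getLast?, b.1 ≠ i).sigma B

theorem mem_nextLetters {v : List (Σ i, β i)} {a : Σ i, β i} :
    a ∈ nextLetters B v ↔ (∀ b ∈ v.getLast?, b.1 ≠ a.1) ∧ a.2 ∈ B a.1 := by
  simp [nextLetters]

open Classical in
theorem sum_filter_getLast_ne (E : ι → ℝ) (v : List (Σ i, β i)) :
    ∑ i with ∀ b ∈ v.getLast?, b.1 ≠ i, E i / (1 + E i) = ratioSum E - lastRatio E v := by
  unfold lastRatio ratioSum
  cases v.getLast? with
  | none => simp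
  | some a =>
    simp only [Option.mem_def, Option.some.injEq, forall_eq', Option.elim_some]
    rw [Finset.filter_ne, Finset.sum_erase_eq_sub (Finset.mem_univ _)]

theorem sum_wordWeight_append (hu : 0 ≤ u) (v : List (Σ i, β i)) :
    ∑ a ∈ nextLetters B v, wordWeight u B (v ++ [a]) =
      wordWeight u B v - (1 - ratioSum (alphabetSum u B)) * (v.map u).prod := by
  classical
  calc ∑ a ∈ nextLetters B v, wordWeight u B (v ++ [a])
      = (v.map u).prod * ∑ i with ∀ b ∈ v.getLast?, b.1 ≠ i,
          alphabetSum u B i / (1 + alphabetSum u B i) := by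
        simp only [wordWeight_append hu, ← Finset.mul_sum, nextLetters, Finset.sum_sigma,
          ← Finset.sum_div]
        rfl
    _ = wordWeight u B v - (1 - ratioSum (alphabetSum u B)) * (v.map u).prod := by
        rw [sum_filter_getLast_ne, wordWeight]
        ring

theorem one_le_tsum_prod_of_forall_exists_eq_firstLetters (hu : 0 ≤ u)
    (h : 1 ≤ ratioSum (alphabetSum u B)) {J : Type*} (w : J → List (Σ i, β i))
    (hw : ∀ x : ℕ → Σ i, β i, (∀ n, x n ∈ nextLetters B (firstLetters x n)) →
      ∃ p n, w p = firstLetters x n) :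
    1 ≤ ∑' p, ENNReal.ofReal ((w p).map u).prod := by
  have hW : ∀ v, ENNReal.ofReal (wordWeight u B v) ≤
      ∑ a ∈ nextLetters B v, ENNReal.ofReal (wordWeight u B (v ++ [a])) := fun v => by
    rw [← ENNReal.ofReal_sum_of_nonneg fun a _ => wordWeight_nonneg hu _,
      sum_wordWeight_append hu]
    refine ENNReal.ofReal_le_ofReal ((le_sub_self_iff _).2 ?_)
    exact mul_nonpos_of_nonpos_of_nonneg (sub_nonpos.2 h) (prod_map_nonneg hu v)
  calc (1 : ℝ≥0∞) = ENNReal.ofReal (wordWeight u B []) := by simp [wordWeight, lastRatio]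
    _ ≤ ∑' p, ENNReal.ofReal (wordWeight u B (w p)) :=
        le_tsum_of_forall_exists_eq_firstLetters hW w hw
    _ ≤ ∑' p, ENNReal.ofReal ((w p).map u).prod :=
        ENNReal.tsum_le_tsum fun p => ENNReal.ofReal_le_ofReal (wordWeight_le_prod hu (w p))

open Classical in
/-- The words of `n` letters over the alphabets `B i` with consecutive letters in different
factors. -/
noncomputable def admissibleWords (B : ∀ i, Finset (β i)) : ℕ → Finset (List (Σ i, β i))
  | 0 => {[]}
  | n + 1 => ((admissibleWords B n).sigma (nextLetters B)).image fun p => p.1 ++ [p.2]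

theorem mem_admissibleWords {v : List (Σ i, β i)} (hchain : v.IsChain fun a b => a.1 ≠ b.1)
    (hB : ∀ a ∈ v, a.2 ∈ B a.1) : v ∈ admissibleWords B v.length := by
  classical
  induction v using List.reverseRecOn with
  | nil => exact Finset.mem_singleton_self _
  | append_singleton v a ih =>
    rw [List.isChain_append] at hchain
    rw [List.length_append, List.length_singleton]
    refine Finset.mem_image.2 ⟨⟨v, a⟩, Finset.mem_sigma.2 ⟨?_, mem_nextLetters.2 ⟨?_, ?_⟩⟩, rfl⟩
    · exact ih hchain.1 fun b hb => hB b (List.mem_append_left _ hb)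
    · exact fun b hb => hchain.2.2 b hb a rfl
    · exact hB a (by simp)

theorem sum_wordWeight_admissibleWords_succ (hu : 0 ≤ u) (n : ℕ) :
    ∑ v ∈ admissibleWords B (n + 1), wordWeight u B v = ∑ v ∈ admissibleWords B n,
      (wordWeight u B v - (1 - ratioSum (alphabetSum u B)) * (v.map u).prod) := by
  classical
  rw [admissibleWords, Finset.sum_image, Finset.sum_sigma]
  · exact Finset.sum_congr rfl fun v _ => sum_wordWeight_append hu v
  · rintro ⟨v, a⟩ - ⟨w, b⟩ - h
    obtain ⟨rfl : v = w, hab⟩ := List.append_inj' h rfl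
    obtain rfl : a = b := List.singleton_inj.1 hab
    rfl

theorem mul_sum_admissibleWords_le_one (hu : 0 ≤ u) (n : ℕ) :
    (1 - ratioSum (alphabetSum u B)) *
      ∑ k ∈ Finset.range n, ∑ v ∈ admissibleWords B k, (v.map u).prod ≤ 1 := by
  suffices h : (1 - ratioSum (alphabetSum u B)) *
      ∑ k ∈ Finset.range n, ∑ v ∈ admissibleWords B k, (v.map u).prod =
        1 - ∑ v ∈ admissibleWords B n, wordWeight u B v from
    h.trans_le (sub_le_self _ (Finset.sum_nonneg fun v _ => wordWeight_nonneg hu v))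
  induction n with
  | zero => simp [admissibleWords, wordWeight, lastRatio]
  | succ n ih =>
    rw [Finset.sum_range_succ, mul_add, ih, sum_wordWeight_admissibleWords_succ hu,
      Finset.sum_sub_distrib, ← Finset.mul_sum]
    ring

end WordWeight

/-! ### Counting words in free products -/

section Counting

open Monoid

variable {ι : Type*} {G : ι → Type*} [∀ i, Group (G i)] {S : ∀ i, Set (G i)} {z : ℝ}

/-- The coefficients `S_i(m + 1)` of the sphere-counting series, shifted as in `sphereTerm`. -/
noncomputable def sphereCoeff (S : ∀ i, Set (G i)) (i : ι) (m : ℕ) : ℝ :=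
  sphereCount S i (m + 1)

theorem sphereCoeff_nonneg : 0 ≤ sphereCoeff S := fun _ _ => Nat.cast_nonneg _

theorem prod_map_pow_letterLength (z : ℝ) (L : List (Σ i, G i)) :
    (L.map fun a => z ^ letterLength S a).prod = z ^ listLength S L := by
  induction L with
  | nil => simp [listLength]
  | cons a L ih =>
    rw [List.map_cons, List.prod_cons, ih, ← pow_add, listLength, listLength, List.map_cons,
      List.sum_cons]

theorem length_le_listLength (hgen : ∀ i, Subgroup.closure (S i) = ⊤) {L : List (Σ i, G i)}
    (hL : ∀ a ∈ L, a.2 ≠ 1) : L.length ≤ listLength S L := by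
  rw [listLength, ← List.length_map (letterLength S)]
  exact List.length_le_sum_of_one_le _
    (List.forall_mem_map.2 fun a ha => letterLength_pos hgen (hL a ha))

theorem letterLength_le_listLength {L : List (Σ i, G i)} {a : Σ i, G i} (ha : a ∈ L) :
    letterLength S a ≤ listLength S L :=
  List.single_le_sum (fun _ _ => Nat.zero_le _) _ (List.mem_map_of_mem ha)

theorem exists_alphabet [Finite ι] (hfinite : ∀ i, (S i).Finite)
    (hgen : ∀ i, Subgroup.closure (S i) = ⊤) (n : ℕ) :
    ∃ B : ∀ i, Finset (G i), ∀ a : Σ i, G i, a.2 ∈ B a.1 ↔ a.2 ≠ 1 ∧ letterLength S a ≤ n := by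
  classical
  exact ⟨fun i => (finite_letterLength_le hfinite hgen i n).toFinset.filter (· ≠ 1), fun a => by
    simp [and_comm]⟩

theorem alphabetSum_pow_letterLength (hgen : ∀ i, Subgroup.closure (S i) = ⊤) {n : ℕ}
    {B : ∀ i, Finset (G i)}
    (hB : ∀ a : Σ i, G i, a.2 ∈ B a.1 ↔ a.2 ≠ 1 ∧ letterLength S a ≤ n) (z : ℝ) :
    alphabetSum (fun a => z ^ letterLength S a) B = partialSum (sphereCoeff S) n z := by
  classical
  funext i
  have hpos : ∀ g ∈ B i, 0 < letterLength S ⟨i, g⟩ := fun g hg =>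
    letterLength_pos hgen ((hB ⟨i, g⟩).1 hg).1
  rw [alphabetSum, partialSum, ← Finset.sum_fiberwise_of_maps_to (t := Finset.range n)
    (g := fun g => letterLength S ⟨i, g⟩ - 1)]
  · refine Finset.sum_congr rfl fun m hm => ?_
    have hfiber : ∀ g, g ∈ B i ∧ letterLength S ⟨i, g⟩ - 1 = m ↔
        letterLength S ⟨i, g⟩ = m + 1 := fun g => by
      refine ⟨fun ⟨hg, _⟩ => by have := hpos g hg; omega, fun hg => ⟨?_, by omega⟩⟩
      refine (hB ⟨i, g⟩).2 ⟨?_, by have := Finset.mem_range.1 hm; omega⟩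
      rintro (rfl : g = 1)
      simp [letterLength] at hg
    have hcount : sphereCount S i (m + 1) =
        ((B i).filter fun g => letterLength S ⟨i, g⟩ - 1 = m).card := by
      rw [sphereCount, ← Set.ncard_coe_finset]
      congr 1
      ext g
      rw [Finset.mem_coe, Finset.mem_filter, hfiber]
      rfl
    rw [sphereCoeff, hcount, ← nsmul_eq_mul, ← Finset.sum_const]
    refine Finset.sum_congr rfl fun g hg => ?_
    rw [(hfiber g).1 (Finset.mem_filter.1 hg)]
  · intro g hg
    have hle := ((hB ⟨i, g⟩).1 hg).2
    have := hpos g hg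
    rw [Finset.mem_range]
    omega

theorem finite_sphere [Finite ι] (hfinite : ∀ i, (S i).Finite)
    (hgen : ∀ i, Subgroup.closure (S i) = ⊤) (m : ℕ) :
    {x : CoprodI G | freeProductLength S x = m}.Finite :=
  (finite_freeProductLength_le hfinite hgen m).subset fun _ hx => le_of_eq hx

variable [Fintype ι]

theorem sum_sphere_pow_le (hgen : ∀ i, Subgroup.closure (S i) = ⊤) (hz : 0 ≤ z) {m : ℕ}
    {B : ∀ i, Finset (G i)} (hB : ∀ a : Σ i, G i, a.2 ≠ 1 → letterLength S a ≤ m → a.2 ∈ B a.1)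
    {T : Finset (CoprodI G)} (hT : ∀ x ∈ T, freeProductLength S x = m) :
    T.card * z ^ m ≤ ∑ k ∈ Finset.range (m + 1), ∑ v ∈ admissibleWords B k,
      (v.map fun a => z ^ letterLength S a).prod := by
  classical
  let code : CoprodI G → Σ _ : ℕ, List (Σ i, G i) := fun x =>
    ⟨(reducedWord x).length, reducedWord x⟩
  have hcode : Function.Injective code := fun x y h => by
    refine reducedWord_injective ?_
    exact congrArg (fun p : Σ _ : ℕ, List (Σ i, G i) => p.2) h
  have hmem : T.image code ⊆ (Finset.range (m + 1)).sigma (admissibleWords B) := by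
    refine Finset.image_subset_iff.2 fun x hx => ?_
    have hlength : listLength S (reducedWord x) = m :=
      (listLength_reducedWord hgen x).trans (hT x hx)
    obtain ⟨hne, hchain⟩ := isReduced_reducedWord x
    refine Finset.mem_sigma.2 ⟨?_, mem_admissibleWords hchain fun a ha => ?_⟩
    · exact Finset.mem_range_succ_iff.2 ((length_le_listLength hgen hne).trans hlength.le)
    · exact hB a (hne a ha) ((letterLength_le_listLength ha).trans hlength.le)
  calc (T.card : ℝ) * z ^ m = ∑ x ∈ T, z ^ freeProductLength S x := by
        rw [Finset.sum_congr rfl fun x hx => by rw [hT x hx], Finset.sum_const, nsmul_eq_mul]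
    _ = ∑ p ∈ T.image code, (p.2.map fun a => z ^ letterLength S a).prod := by
        rw [Finset.sum_image hcode.injOn]
        refine Finset.sum_congr rfl fun x _ => ?_
        rw [prod_map_pow_letterLength, listLength_reducedWord hgen]
    _ ≤ ∑ p ∈ (Finset.range (m + 1)).sigma (admissibleWords B),
          (p.2.map fun a => z ^ letterLength S a).prod :=
        Finset.sum_le_sum_of_subset_of_nonneg hmem fun p _ _ =>
          prod_map_nonneg (fun a => pow_nonneg hz _) p.2
    _ = _ := Finset.sum_sigma _ _ _

theorem exists_encard_sphere_le (hfinite : ∀ i, (S i).Finite)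
    (hgen : ∀ i, Subgroup.closure (S i) = ⊤) (hz : 0 < z)
    (hs : ∀ i, Summable fun m => sphereCoeff S i m * z ^ (m + 1))
    (hlt : ratioSum (seriesSum (sphereCoeff S) z) < 1) :
    ∃ K : ℝ, 0 < K ∧ ∀ m : ℕ, ({x | freeProductLength S x = m}.encard : ℝ≥0∞) ≤
      ENNReal.ofReal (K * (z ^ m)⁻¹) := by
  have hgap : 0 < 1 - ratioSum (seriesSum (sphereCoeff S) z) := sub_pos.2 hlt
  refine ⟨_, inv_pos.2 hgap, fun m => ?_⟩
  obtain ⟨B, hB⟩ := exists_alphabet hfinite hgen m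
  set T := (finite_sphere hfinite hgen m).toFinset
  have hT : ∀ x ∈ T, freeProductLength S x = m := fun x => (Set.Finite.mem_toFinset _).1
  have hpartial : ratioSum (partialSum (sphereCoeff S) m z) ≤
      ratioSum (seriesSum (sphereCoeff S) z) :=
    ratioSum_mono (partialSum_nonneg sphereCoeff_nonneg hz.le m)
      (partialSum_le_seriesSum sphereCoeff_nonneg hz.le hs m)
  have hcard : (1 - ratioSum (seriesSum (sphereCoeff S) z)) * (T.card * z ^ m) ≤ 1 := by
    refine le_trans ?_ (mul_sum_admissibleWords_le_one (B := B)
      (u := fun a => z ^ letterLength S a) (fun a => pow_nonneg hz.le _) (m + 1))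
    rw [alphabetSum_pow_letterLength hgen hB]
    gcongr
    · exact sub_nonneg.2 (hpartial.trans hlt.le)
    · exact sum_sphere_pow_le hgen hz.le (fun a h₁ h₂ => (hB a).2 ⟨h₁, h₂⟩) hT
  rw [(finite_sphere hfinite hgen m).encard_eq_coe_toFinset_card]
  refine (ENNReal.ofReal_natCast T.card).symm.trans_le (ENNReal.ofReal_le_ofReal ?_)
  rw [← div_eq_mul_inv, le_div_iff₀ (by positivity)]
  exact (le_inv_mul_iff₀ hgap).2 hcard |>.trans_eq (mul_one _)

theorem one_le_tsum_pow_listLength (hfinite : ∀ i, (S i).Finite)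
    (hgen : ∀ i, Subgroup.closure (S i) = ⊤) (hz : 0 ≤ z) {N : ℕ}
    (h : 1 ≤ ratioSum (partialSum (sphereCoeff S) N z)) {J : Type*} (w : J → List (Σ i, G i))
    (hw : ∀ x : ℕ → Σ i, G i, IsInfiniteWord x → (∀ n, letterLength S (x n) ≤ N) →
      ∃ p n, w p = firstLetters x n) :
    1 ≤ ∑' p, ENNReal.ofReal (z ^ listLength S (w p)) := by
  obtain ⟨B, hB⟩ := exists_alphabet hfinite hgen N
  simp only [← prod_map_pow_letterLength]
  refine one_le_tsum_prod_of_forall_exists_eq_firstLetters (B := B) (fun a => pow_nonneg hz _)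
    (by rwa [alphabetSum_pow_letterLength hgen hB]) w fun x hx => ?_
  have hletter : ∀ n, (x n).2 ≠ 1 ∧ letterLength S (x n) ≤ N := fun n =>
    (hB _).1 (mem_nextLetters.1 (hx n)).2
  have hne : ∀ n, (x n).1 ≠ (x (n + 1)).1 := fun n =>
    (mem_nextLetters.1 (hx (n + 1))).1 (x n) (by simp [firstLetters_succ])
  exact hw x (fun n => ⟨(hletter n).1, hne n⟩) fun n => (hletter n).2

end Counting

/-! ### Ends of connected locally finite graphs -/

section EndsOfGraph

variable {V : Type*} {X : SimpleGraph V} {o : V}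

theorem ballBelow_mono {m n : ℕ} (h : m ≤ n) : ballBelow X o m ⊆ ballBelow X o n :=
  fun _ hx => lt_of_lt_of_le hx h

theorem componentCompl_eq_of_mem_of_mem {K : Set V} {C D : X.ComponentCompl K} {v : V}
    (hC : v ∈ C) (hD : v ∈ D) : C = D := by
  obtain ⟨_, rfl⟩ := hC
  obtain ⟨_, rfl⟩ := hD
  rfl

theorem componentCompl_induction {K : Set V} {C : X.ComponentCompl K} {P : V → Prop}
    (hadj : ∀ u v, u ∉ K → X.Adj u v → P u → P v) {u v : V} (hu : u ∈ C) (hv : v ∈ C)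
    (h : P u) : P v := by
  obtain ⟨huK, rfl⟩ := hu
  obtain ⟨hvK, huv⟩ := hv
  obtain ⟨p⟩ := SimpleGraph.ConnectedComponent.eq.1 huv.symm
  have hwalk : ∀ a b : (Kᶜ : Set V), (X.induce Kᶜ).Walk a b → P a.1 → P b.1 := by
    intro a b p
    induction p with
    | nil => exact id
    | @cons a _ _ hab _ ih => exact fun ha => ih (hadj _ _ a.2 hab ha)
  exact hwalk _ _ p h

theorem RootedRay.eventually_notMem (r : RootedRay X o) {A : Set V} (hA : A.Finite) :
    ∀ᶠ n in atTop, r.vertex n ∉ A := by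
  have := r.injective.tendsto_cofinite.eventually hA.compl_mem_cofinite
  rwa [Nat.cofinite_eq_atTop] at this

theorem RootedRay.dist_vertex_succ_le (hX : X.Connected) (r : RootedRay X o) (n : ℕ) :
    X.dist o (r.vertex (n + 1)) ≤ X.dist o (r.vertex n) + 1 := by
  have := hX.dist_triangle (u := o) (v := r.vertex n) (w := r.vertex (n + 1))
  rwa [SimpleGraph.dist_eq_one_iff_adj.2 (r.adj_succ n)] at this

theorem RootedRay.exists_last_exit (hX : X.Connected) (r : RootedRay X o) {m : ℕ}
    (hm : (ballBelow X o m).Finite) :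
    ∃ N, X.dist o (r.vertex N) = m ∧ ∀ n, N ≤ n → r.vertex n ∉ ballBelow X o m := by
  classical
  have hex : ∃ N, ∀ n, N ≤ n → r.vertex n ∉ ballBelow X o m :=
    eventually_atTop.1 (r.eventually_notMem hm)
  refine ⟨Nat.find hex, le_antisymm ?_ (not_lt.1 (Nat.find_spec hex _ le_rfl)), Nat.find_spec hex⟩
  rcases hN : Nat.find hex with _ | k
  · rw [r.vertex_zero, SimpleGraph.dist_self]
    exact Nat.zero_le _
  · have hnot := Nat.find_min hex (m := k) (by omega)
    push Not at hnot
    obtain ⟨n, hkn, hn⟩ := hnot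
    have hnk : n = k := by
      by_contra hne
      exact Nat.find_spec hex n (by omega) hn
    rw [hnk] at hn
    exact (r.dist_vertex_succ_le hX k).trans hn

theorem RootedRay.exists_eventually_mem_componentCompl (hX : X.Connected)
    (r : RootedRay X o) {m : ℕ} (hm : (ballBelow X o m).Finite) :
    ∃ C : X.ComponentCompl (ballBelow X o m),
      (∃ v ∈ C, X.dist o v = m) ∧ ∀ᶠ n in atTop, r.vertex n ∈ C := by
  obtain ⟨N, hdist, hN⟩ := r.exists_last_exit hX hm
  have hmem : ∀ n, N ≤ n → r.vertex n ∈ X.componentComplMk (hN N le_rfl) := by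
    intro n hn
    induction n, hn using Nat.le_induction with
    | base => exact X.componentComplMk_mem _
    | succ n hn ih =>
      exact SimpleGraph.ComponentCompl.mem_of_adj _ _ ih (hN _ (hn.trans n.le_succ)) (r.adj_succ n)
  exact ⟨_, ⟨r.vertex N, hmem N le_rfl, hdist⟩, eventually_atTop.2 ⟨N, hmem⟩⟩

theorem RootedRay.nonempty_inter_of_infinite {r s : RootedRay X o}
    (h : (Set.range r.vertex ∩ Set.range s.vertex).Infinite) {A B : Set V}
    (hr : ∀ᶠ n in atTop, r.vertex n ∈ A) (hs : ∀ᶠ n in atTop, s.vertex n ∈ B) :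
    (A ∩ B).Nonempty := by
  obtain ⟨M, hM⟩ := eventually_atTop.1 hr
  obtain ⟨N, hN⟩ := eventually_atTop.1 hs
  obtain ⟨v, ⟨⟨m, rfl⟩, ⟨n, hn⟩⟩, hv⟩ := (h.sdiff (((Set.finite_Iio M).image r.vertex).union
    ((Set.finite_Iio N).image s.vertex))).nonempty
  simp only [Set.mem_union, Set.mem_image, Set.mem_Iio, not_or, not_exists, not_and] at hv
  exact ⟨r.vertex m, hM m (not_lt.1 fun h => hv.1 m h rfl),
    hn ▸ hN n (not_lt.1 fun h => hv.2 n h hn)⟩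

theorem RayEquiv.symm {r s : RootedRay X o} (h : RayEquiv r s) : RayEquiv s r :=
  let ⟨t, h1, h2⟩ := h
  ⟨t, h2, h1⟩

theorem RayEquiv.eventually_mem (hX : X.Connected) {r s : RootedRay X o} (h : RayEquiv r s) {m : ℕ}
    (hm : (ballBelow X o m).Finite) {C : X.ComponentCompl (ballBelow X o m)}
    (hr : ∀ᶠ n in atTop, r.vertex n ∈ C) : ∀ᶠ n in atTop, s.vertex n ∈ C := by
  obtain ⟨t, htr, hts⟩ := h
  obtain ⟨D, -, hD⟩ := t.exists_eventually_mem_componentCompl hX hm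
  obtain ⟨F, -, hF⟩ := s.exists_eventually_mem_componentCompl hX hm
  obtain ⟨v, hvD, hvC⟩ := RootedRay.nonempty_inter_of_infinite (A := D) (B := C) htr hD hr
  obtain ⟨w, hwD, hwF⟩ := RootedRay.nonempty_inter_of_infinite (A := D) (B := F) hts hD hF
  rw [← componentCompl_eq_of_mem_of_mem hvD hvC, componentCompl_eq_of_mem_of_mem hwD hwF]
  exact hF

theorem RootedRay.containedIn_toEnd (hX : X.Connected) {r : RootedRay X o} {m : ℕ}
    (hm : (ballBelow X o m).Finite) {C : X.ComponentCompl (ballBelow X o m)}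
    (hr : ∀ᶠ n in atTop, r.vertex n ∈ C) : r.toEnd.ContainedIn (C : Set V) := by
  intro s hs
  have hlift : ∀ r s : RootedRay X o, RayEquiv r s →
      (∀ᶠ n in atTop, r.vertex n ∈ C) = ∀ᶠ n in atTop, s.vertex n ∈ C := fun r s h =>
    propext ⟨h.eventually_mem hX hm, h.symm.eventually_mem hX hm⟩
  exact (congrArg (Quot.lift (fun r : RootedRay X o => ∀ᶠ n in atTop, r.vertex n ∈ C) hlift) hs).mpr
    hr

theorem EndSpace.exists_containedIn (hX : X.Connected) (ω : EndSpace X o) {m : ℕ}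
    (hm : (ballBelow X o m).Finite) :
    ∃ C : X.ComponentCompl (ballBelow X o m),
      ω.ContainedIn (C : Set V) ∧ ∃ v ∈ C, X.dist o v = m := by
  obtain ⟨r, rfl⟩ := Quot.exists_rep ω
  obtain ⟨C, hv, hC⟩ := r.exists_eventually_mem_componentCompl hX hm
  exact ⟨C, RootedRay.containedIn_toEnd hX hm hC, hv⟩

theorem SameComponent.containedIn {m n : ℕ} (hmn : m ≤ n) {ω₁ ω₂ : EndSpace X o}
    (h : SameComponent n ω₁ ω₂) {C : X.ComponentCompl (ballBelow X o m)}
    (hC : ω₁.ContainedIn (C : Set V)) : ω₂.ContainedIn (C : Set V) := by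
  obtain ⟨D, hD₁, hD₂⟩ := h
  obtain ⟨r, hr⟩ := Quot.exists_rep ω₁
  obtain ⟨k, hkC, hkD⟩ := ((hC r hr).and (hD₁ r hr)).exists
  have hsub := D.subset_hom (ballBelow_mono hmn)
  rw [componentCompl_eq_of_mem_of_mem (hsub hkD) hkC] at hsub
  exact fun s hs => (hD₂ s hs).mono fun n hn => hsub hn

theorem exists_sameComponent_of_le_confluence {m : ℕ} (hm : m ≠ 0) {ω₁ ω₂ : EndSpace X o}
    (h : (m : ℕ∞) ≤ confluence ω₁ ω₂) : ∃ n, m ≤ n ∧ SameComponent n ω₁ ω₂ := by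
  by_contra! hcon
  have : confluence ω₁ ω₂ ≤ ((m - 1 : ℕ) : ℕ∞) := by
    refine iSup₂_le fun n hn => ?_
    have : n < m := not_le.1 fun hmn => hcon n hmn hn
    exact_mod_cast Nat.le_sub_one_of_lt this
  have := h.trans this
  norm_cast at this
  omega

theorem SameComponent.endDist_le {α : ℝ} (hα₀ : 0 < α) (hα₁ : α < 1) {m : ℕ}
    {ω₁ ω₂ : EndSpace X o} (h : SameComponent m ω₁ ω₂) : endDist α ω₁ ω₂ ≤ α ^ m := by
  unfold endDist
  split_ifs with htop
  · positivity
  · refine pow_le_pow_of_le_one hα₀.le hα₁.le ?_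
    have hle : (m : ℕ∞) ≤ confluence ω₁ ω₂ := le_iSup₂_of_le m h le_rfl
    rw [← ENat.natCast_toNat htop] at hle
    exact_mod_cast hle

theorem exists_sameComponent_of_endDist_lt {α : ℝ} (hα₀ : 0 < α) (hα₁ : α < 1) {m : ℕ}
    {ω₁ ω₂ : EndSpace X o} (h : endDist α ω₁ ω₂ < α ^ m) :
    ∃ n, m + 1 ≤ n ∧ SameComponent n ω₁ ω₂ := by
  refine exists_sameComponent_of_le_confluence m.succ_ne_zero ?_
  unfold endDist at h
  split_ifs at h with htop
  · exact htop ▸ le_top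
  · have := (pow_lt_pow_iff_right_of_lt_one₀ hα₀ hα₁).1 h
    rw [← ENat.natCast_toNat htop]
    exact_mod_cast this

theorem coverNumber_endDist_pow_le {α : ℝ} (hα₀ : 0 < α) (hα₁ : α < 1) (hX : X.Connected) {m : ℕ}
    (hm : (ballBelow X o (m + 1)).Finite) (A : Set (EndSpace X o)) :
    coverNumber (endDist α) A (α ^ m) ≤ {v | X.dist o v = m}.encard := by
  choose comp hcomp vert hvert hdist using fun ω : EndSpace X o =>
    ω.exists_containedIn hX (hm.subset (ballBelow_mono m.le_succ))
  have hclose : ∀ ω ω', vert ω = vert ω' → endDist α ω ω' ≤ α ^ m := fun ω ω' h =>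
    SameComponent.endDist_le hα₀ hα₁ ⟨comp ω, hcomp ω,
      componentCompl_eq_of_mem_of_mem (h ▸ hvert ω') (hvert ω) ▸ hcomp ω'⟩
  obtain ⟨B, hBA, hB⟩ := Set.exists_subset_bijOn A vert
  have hsphere : vert '' A ⊆ {v | X.dist o v = m} := Set.image_subset_iff.2 fun ω _ => hdist ω
  have hfinite : B.Finite := hB.finite_iff_finite.2 <| hm.subset fun v hv =>
    Nat.lt_succ_of_le (hsphere hv).le
  have hcover : IsBallCover (endDist α) A ((·, α ^ m) '' B) := by
    refine ⟨(hfinite.image _).countable, ?_, fun ω hω => ?_⟩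
    · rintro _ ⟨ω, hω, rfl⟩
      exact ⟨hBA hω, pow_pos hα₀ m⟩
    · obtain ⟨ω', hω', h⟩ := hB.surjOn ⟨ω, hω, rfl⟩
      exact ⟨_, ⟨ω', hω', rfl⟩, hclose ω' ω h⟩
  calc coverNumber (endDist α) A (α ^ m) ≤ ((·, α ^ m) '' B).encard :=
        coverNumber_le_encard hcover (by rintro _ ⟨ω, -, rfl⟩; exact le_rfl)
    _ ≤ B.encard := Set.encard_image_le _ _
    _ = (vert '' A).encard := by rw [← hB.image_eq, hB.injOn.encard_image]
    _ ≤ _ := Set.encard_le_encard hsphere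

/-- The vertex `u` lies on a geodesic from `o` to each `v k` that is at least as far from `o`
as `u` is. -/
def LiesOnGeodesicsTo (X : SimpleGraph V) (o : V) (v : ℕ → V) (u : V) : Prop :=
  ∀ k, X.dist o u ≤ X.dist o (v k) → X.dist o u + X.dist u (v k) = X.dist o (v k)

theorem LiesOnGeodesicsTo.exists_adj (hX : X.Connected) {v : ℕ → V}
    (hv : ∀ j k, j ≤ k → X.dist o (v j) + X.dist (v j) (v k) = X.dist o (v k))
    (hmono : StrictMono fun k => X.dist o (v k)) {u : V} (hu : LiesOnGeodesicsTo X o v u) :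
    ∃ w, X.Adj u w ∧ X.dist o w = X.dist o u + 1 ∧ LiesOnGeodesicsTo X o v w := by
  classical
  have hex : ∃ k, X.dist o u + 1 ≤ X.dist o (v k) := ⟨_, hmono.le_apply⟩
  set k := Nat.find hex
  have hfar : X.dist o u + 1 ≤ X.dist o (v k) := Nat.find_spec hex
  have huk := hu k (by omega)
  obtain ⟨w, huw, hwk⟩ := exists_dist_eq_dist_eq hX (u := u) (v := v k) (m := 1)
    (n := X.dist o (v k) - (X.dist o u + 1)) (by omega)
  have how := hX.dist_triangle (u := o) (v := u) (w := w)
  have howk := hX.dist_triangle (u := o) (v := w) (w := v k)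
  refine ⟨w, SimpleGraph.dist_eq_one_iff_adj.1 huw, by omega, fun j hj => ?_⟩
  have hkj : k ≤ j := Nat.find_min' hex (by omega)
  have hwkj := hX.dist_triangle (u := w) (v := v k) (w := v j)
  have howj := hX.dist_triangle (u := o) (v := w) (w := v j)
  have hvkj := hv k j hkj
  omega

theorem exists_rootedRay_of_geodesic (hX : X.Connected) {v : ℕ → V}
    (hv : ∀ j k, j ≤ k → X.dist o (v j) + X.dist (v j) (v k) = X.dist o (v k))
    (hmono : StrictMono fun k => X.dist o (v k)) :
    ∃ r : RootedRay X o, ∀ k, r.vertex (X.dist o (v k)) = v k := by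
  have hroot : LiesOnGeodesicsTo X o v o := fun k _ => by rw [SimpleGraph.dist_self, zero_add]
  choose next hadj hdist hnext using fun u : {u // LiesOnGeodesicsTo X o v u} =>
    u.2.exists_adj hX hv hmono
  let path : ℕ → {u // LiesOnGeodesicsTo X o v u} := fun n =>
    (fun u => ⟨next u, hnext u⟩)^[n] ⟨o, hroot⟩
  have hsucc : ∀ n, (path (n + 1)).1 = next (path n) := fun n => by
    simp only [path, Function.iterate_succ_apply']
  have hpath : ∀ n, X.dist o (path n).1 = n := fun n => by
    induction n with
    | zero => exact SimpleGraph.dist_self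
    | succ n ih => rw [hsucc, hdist, ih]
  refine ⟨⟨fun n => (path n).1, rfl, fun n => hsucc n ▸ hadj _, fun m n hmn => ?_⟩, fun k => ?_⟩
  · rw [← hpath m, ← hpath n]
    exact congrArg (X.dist o) hmn
  · have := (path (X.dist o (v k))).2 k (hpath _).le
    rw [hpath] at this
    exact hX.dist_eq_zero_iff.1 (Nat.add_eq_left.1 this)

end EndsOfGraph

/-! ### Balls in the space of ends of a free product -/

section BallsOfEnds

open Monoid

variable {ι : Type*} {G : ι → Type*} [∀ i, Group (G i)] {S : ∀ i, Set (G i)}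

theorem wordPrefix_eq_listProd (x : ℕ → Σ i, G i) (n : ℕ) :
    wordPrefix x n = listProd (firstLetters x n) := by
  simp [wordPrefix, listProd, firstLetters, Function.comp_def]

theorem listLength_firstLetters_succ (x : ℕ → Σ i, G i) (n : ℕ) :
    listLength S (firstLetters x (n + 1)) =
      listLength S (firstLetters x n) + letterLength S (x n) := by
  rw [firstLetters_succ, listLength_append]
  simp [listLength]

theorem IsInfiniteWord.isReducedWord {x : ℕ → Σ i, G i} (hx : IsInfiniteWord x) (n : ℕ) :
    IsReducedWord (firstLetters x n) := by
  refine ⟨fun a ha => ?_, List.isChain_iff_getElem.2 fun k hk => ?_⟩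
  · obtain ⟨k, -, rfl⟩ := List.mem_map.1 ha
    exact (hx k).1
  · simpa [firstLetters] using (hx k).2

theorem IsInfiniteWord.strictMono_listLength (hgen : ∀ i, Subgroup.closure (S i) = ⊤)
    {x : ℕ → Σ i, G i} (hx : IsInfiniteWord x) :
    StrictMono fun n => listLength S (firstLetters x n) :=
  strictMono_nat_of_lt_succ fun n => by
    rw [listLength_firstLetters_succ]
    exact Nat.lt_add_of_pos_right (letterLength_pos hgen (hx n).1)

theorem IsInfiniteWord.exists_listLength_le_lt (hgen : ∀ i, Subgroup.closure (S i) = ⊤)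
    {x : ℕ → Σ i, G i} (hx : IsInfiniteWord x) (m : ℕ) :
    ∃ k, listLength S (firstLetters x k) ≤ m ∧ m < listLength S (firstLetters x (k + 1)) := by
  obtain ⟨k, hk, hk'⟩ := Nat.exists_not_and_succ_of_not_zero_of_exists
    (p := fun k => m < listLength S (firstLetters x k)) (by simp [firstLetters, listLength])
    ⟨m + 1, (hx.strictMono_listLength hgen).le_apply⟩
  exact ⟨k, not_lt.1 hk, hk'⟩

/-- The end `ω` is the limit of the prefixes of the infinite word `x`. Unlike membership in
`infiniteWordEnds`, this does not refer to any particular representative of `ω`. -/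
def IsLimitOfWord (ω : FreeProductEnds S) (x : ℕ → Σ i, G i) : Prop :=
  IsInfiniteWord x ∧ ∀ A, ω.ContainedIn A → ∀ᶠ n in atTop, listProd (firstLetters x n) ∈ A

theorem IsInfiniteWord.exists_isLimitOfWord (hgen : ∀ i, Subgroup.closure (S i) = ⊤)
    {x : ℕ → Σ i, G i} (hx : IsInfiniteWord x) :
    ∃ ω ∈ infiniteWordEnds S, IsLimitOfWord ω x := by
  have hdist : ∀ n, (freeProductGraph S).dist 1 (listProd (firstLetters x n)) =
      listLength S (firstLetters x n) := fun n =>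
    freeProductLength_listProd hgen (hx.isReducedWord n)
  have hmono : StrictMono fun n => (freeProductGraph S).dist 1 (listProd (firstLetters x n)) := by
    simpa only [hdist] using hx.strictMono_listLength hgen
  have hgeodesic : ∀ j k, j ≤ k → (freeProductGraph S).dist 1 (listProd (firstLetters x j)) +
      (freeProductGraph S).dist (listProd (firstLetters x j)) (listProd (firstLetters x k)) =
        (freeProductGraph S).dist 1 (listProd (firstLetters x k)) := by
    intro j k hjk
    refine le_antisymm ?_ (freeProductGraph_connected hgen).dist_triangle
    obtain ⟨t, ht⟩ := firstLetters_prefix x hjk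
    rw [hdist, hdist, ← freeProductLength_inv_mul hgen, ← ht, listProd_append,
      inv_mul_cancel_left, listLength_append]
    exact Nat.add_le_add_left (freeProductLength_listProd_le hgen t) _
  obtain ⟨r, hr⟩ := exists_rootedRay_of_geodesic (freeProductGraph_connected hgen) hgeodesic hmono
  refine ⟨r.toEnd, ⟨x, hx, r, rfl, fun n => ⟨_, (hr n).trans (wordPrefix_eq_listProd x n).symm⟩⟩,
    hx, fun A hA => ?_⟩
  simpa only [hr] using hmono.tendsto_atTop.eventually (hA r rfl)

theorem finite_ballBelow_freeProductGraph [Finite ι] (hfinite : ∀ i, (S i).Finite)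
    (hgen : ∀ i, Subgroup.closure (S i) = ⊤) (m : ℕ) :
    (ballBelow (freeProductGraph S) 1 m).Finite :=
  (finite_freeProductLength_le hfinite hgen m).subset fun _ hx => le_of_lt (α := ℕ) hx

/-- A path can leave the set of elements whose word starts with `w` only through `listProd w`, which
lies in the removed ball. -/
theorem prefix_reducedWord_of_mem_componentCompl {m : ℕ}
    {C : (freeProductGraph S).ComponentCompl (ballBelow (freeProductGraph S) 1 m)}
    {w : List (Σ i, G i)} (hw : freeProductLength S (listProd w) < m) {u v : CoprodI G}
    (hu : u ∈ C) (hv : v ∈ C) (hwu : w <+: reducedWord u) : w <+: reducedWord v := by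
  refine componentCompl_induction (P := fun u => w <+: reducedWord u) ?_ hu hv hwu
  intro a b ha hab hwa
  obtain ⟨-, i, s, -, rfl⟩ := freeProductGraph_adj_iff.1 hab
  by_contra hwb
  rw [eq_of_prefix_of_not_prefix hwa hwb, listProd_reducedWord] at hw
  exact ha hw

theorem IsLimitOfWord.firstLetters_eq_of_containedIn (hgen : ∀ i, Subgroup.closure (S i) = ⊤)
    {ω₁ ω₂ : FreeProductEnds S} {x y : ℕ → Σ i, G i} (hx : IsLimitOfWord ω₁ x)
    (hy : IsLimitOfWord ω₂ y) {m k : ℕ}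
    {C : (freeProductGraph S).ComponentCompl (ballBelow (freeProductGraph S) 1 m)}
    (h₁ : ω₁.ContainedIn (C : Set (CoprodI G))) (h₂ : ω₂.ContainedIn (C : Set (CoprodI G)))
    (hk : listLength S (firstLetters x k) < m) : firstLetters x k = firstLetters y k := by
  obtain ⟨p, hpC, hkp⟩ := ((hx.2 _ h₁).and (eventually_ge_atTop k)).exists
  obtain ⟨q, hqC, hkq⟩ := ((hy.2 _ h₂).and (eventually_ge_atTop k)).exists
  have hprefix := prefix_reducedWord_of_mem_componentCompl
    ((freeProductLength_listProd_le hgen _).trans_lt hk) hpC hqC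
    (by rw [reducedWord_listProd (hx.1.isReducedWord p)]; exact firstLetters_prefix x hkp)
  rw [reducedWord_listProd (hy.1.isReducedWord q)] at hprefix
  exact (List.prefix_of_prefix_length_le hprefix (firstLetters_prefix y hkq) (by simp)).eq_of_length
    (by simp)

theorem IsLimitOfWord.firstLetters_eq_of_endDist_lt [Finite ι] (hfinite : ∀ i, (S i).Finite)
    (hgen : ∀ i, Subgroup.closure (S i) = ⊤) {α : ℝ} (hα₀ : 0 < α) (hα₁ : α < 1)
    {ω ω₁ ω₂ : FreeProductEnds S} {x y : ℕ → Σ i, G i} (hx : IsLimitOfWord ω₁ x)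
    (hy : IsLimitOfWord ω₂ y) {m k : ℕ} (h₁ : endDist α ω ω₁ < α ^ m)
    (h₂ : endDist α ω ω₂ < α ^ m) (hk : listLength S (firstLetters x k) ≤ m) :
    firstLetters x k = firstLetters y k := by
  obtain ⟨n₁, hn₁, hsame₁⟩ := exists_sameComponent_of_endDist_lt hα₀ hα₁ h₁
  obtain ⟨n₂, hn₂, hsame₂⟩ := exists_sameComponent_of_endDist_lt hα₀ hα₁ h₂
  obtain ⟨C, hC, -⟩ := ω.exists_containedIn (freeProductGraph_connected hgen)
    (finite_ballBelow_freeProductGraph hfinite hgen (m + 1))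
  exact hx.firstLetters_eq_of_containedIn hgen hy (hsame₁.containedIn hn₁ hC)
    (hsame₂.containedIn hn₂ hC) (Nat.lt_succ_of_le hk)

theorem exists_pow_succ_le_lt_pow {α : ℝ} (hα₁ : α < 1) {ε : ℝ} (hε₀ : 0 < ε)
    (hε₁ : ε < 1) : ∃ m : ℕ, α ^ (m + 1) ≤ ε ∧ ε < α ^ m := by
  obtain ⟨m, hm, hm'⟩ := Nat.exists_not_and_succ_of_not_zero_of_exists (p := fun m => α ^ m ≤ ε)
    (by simpa only [pow_zero] using hε₁.not_ge)
    ((exists_pow_lt_of_lt_one hε₀ hα₁).imp fun _ h => h.le)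
  exact ⟨m, hm', not_le.1 hm⟩

theorem IsLimitOfWord.exists_common_prefix_of_ball [Finite ι] (hfinite : ∀ i, (S i).Finite)
    (hgen : ∀ i, Subgroup.closure (S i) = ⊤) {α : ℝ} (hα₀ : 0 < α) (hα₁ : α < 1) {δ : ℝ}
    (hδ : 0 ≤ δ) {ω ω' : FreeProductEnds S} {x : ℕ → Σ i, G i} (hx : IsLimitOfWord ω' x) {N : ℕ}
    (hN : ∀ n, letterLength S (x n) ≤ N) {ε : ℝ} (hε₁ : ε < 1) (hε₀ : 0 < ε)
    (hω' : endDist α ω ω' ≤ ε) :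
    ∃ w : List (Σ i, G i), (α ^ δ) ^ listLength S w * (α ^ δ) ^ N ≤ ε ^ δ ∧
      ∀ (ω'' : FreeProductEnds S) y, IsLimitOfWord ω'' y → endDist α ω ω'' ≤ ε →
        ∃ n, w = firstLetters y n := by
  obtain ⟨m, hmε, hεm⟩ := exists_pow_succ_le_lt_pow hα₁ hε₀ hε₁
  obtain ⟨k, hkm, hmk⟩ := hx.1.exists_listLength_le_lt hgen m
  refine ⟨firstLetters x k, ?_, fun ω'' y hy hω'' => ⟨k, hx.firstLetters_eq_of_endDist_lt hfinite
    hgen hα₀ hα₁ hy (hω'.trans_lt hεm) (hω''.trans_lt hεm) hkm⟩⟩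
  have hlen : m + 1 ≤ listLength S (firstLetters x k) + N := by
    rw [listLength_firstLetters_succ] at hmk
    exact hmk.trans_le (Nat.add_le_add_left (hN k) _)
  calc (α ^ δ) ^ listLength S (firstLetters x k) * (α ^ δ) ^ N
      = (α ^ δ) ^ (listLength S (firstLetters x k) + N) := (pow_add _ _ _).symm
    _ ≤ (α ^ δ) ^ (m + 1) := pow_le_pow_of_le_one (Real.rpow_nonneg hα₀.le δ)
        (Real.rpow_le_one hα₀.le hα₁.le hδ) hlen
    _ = (α ^ (m + 1)) ^ δ := Real.rpow_pow_comm hα₀.le δ (m + 1)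
    _ ≤ ε ^ δ := Real.rpow_le_rpow (by positivity) hmε hδ

theorem le_hausdorffContent_of_one_le_ratioSum [Fintype ι] (hfinite : ∀ i, (S i).Finite)
    (hgen : ∀ i, Subgroup.closure (S i) = ⊤) {α : ℝ} (hα₀ : 0 < α) (hα₁ : α < 1) {δ : ℝ}
    (hδ : 0 ≤ δ) {N : ℕ} (hN : 1 ≤ ratioSum (partialSum (sphereCoeff S) N (α ^ δ)))
    {A : Set (FreeProductEnds S)} (hA : infiniteWordEnds S ⊆ A) :
    ENNReal.ofReal ((α ^ δ) ^ N) ≤ hausdorffContent (endDist α) A δ 1 := by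
  refine le_iInf₂ fun C ⟨hC, hC₁⟩ => ?_
  have hz : 0 ≤ α ^ δ := Real.rpow_nonneg hα₀.le δ
  let J : Type _ := {p : C // ∃ (ω : FreeProductEnds S) (x : ℕ → Σ i, G i), IsLimitOfWord ω x ∧
    (∀ n, letterLength S (x n) ≤ N) ∧ endDist α p.1.1 ω ≤ p.1.2}
  have hball : ∀ p : J, ∃ w : List (Σ i, G i),
      (α ^ δ) ^ listLength S w * (α ^ δ) ^ N ≤ p.1.1.2 ^ δ ∧
      ∀ (ω : FreeProductEnds S) y, IsLimitOfWord ω y → endDist α p.1.1.1 ω ≤ p.1.1.2 →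
        ∃ n, w = firstLetters y n := fun ⟨⟨p, hp⟩, ω, x, hx, hxN, hdist⟩ =>
    hx.exists_common_prefix_of_ball hfinite hgen hα₀ hα₁ hδ hxN (hC₁ p hp) (hC.2.1 p hp).2 hdist
  choose w hcost hw using hball
  have hmeet : ∀ x, IsInfiniteWord x → (∀ n, letterLength S (x n) ≤ N) →
      ∃ p n, w p = firstLetters x n := by
    intro x hx hxN
    obtain ⟨ω, hω, hxω⟩ := hx.exists_isLimitOfWord hgen
    obtain ⟨p, hpC, hp⟩ := hC.2.2 ω (hA hω)
    exact ⟨⟨⟨p, hpC⟩, ω, x, hxω, hxN, hp⟩, hw _ ω x hxω hp⟩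
  calc ENNReal.ofReal ((α ^ δ) ^ N)
      ≤ (∑' p : J, ENNReal.ofReal ((α ^ δ) ^ listLength S (w p))) *
          ENNReal.ofReal ((α ^ δ) ^ N) :=
        le_mul_of_one_le_left' (one_le_tsum_pow_listLength hfinite hgen hz hN w hmeet)
    _ = ∑' p : J, ENNReal.ofReal ((α ^ δ) ^ listLength S (w p) * (α ^ δ) ^ N) := by
        rw [← ENNReal.tsum_mul_right]
        exact tsum_congr fun p => (ENNReal.ofReal_mul (pow_nonneg hz _)).symm
    _ ≤ ∑' p : J, ENNReal.ofReal (p.1.1.2 ^ δ) :=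
        ENNReal.tsum_le_tsum fun p => ENNReal.ofReal_le_ofReal (hcost p)
    _ ≤ ∑' p : C, ENNReal.ofReal (p.1.2 ^ δ) :=
        ENNReal.tsum_comp_le_tsum_of_injective Subtype.val_injective
          fun p : C => ENNReal.ofReal (p.1.2 ^ δ)

end BallsOfEnds

/-! ### Dimensions of the space of ends of a free product -/

section Dimensions

open Monoid

variable {ι : Type*} {G : ι → Type*} [∀ i, Group (G i)] {S : ∀ i, Set (G i)}

theorem exists_one_le_sphereCoeff [Finite ι] (hfinite : ∀ i, (S i).Finite)
    (hgen : ∀ i, Subgroup.closure (S i) = ⊤) (i : ι) [Nontrivial (G i)] :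
    ∃ m, 1 ≤ sphereCoeff S i m := by
  obtain ⟨g, hg⟩ := exists_ne (1 : G i)
  obtain ⟨m, hm⟩ := Nat.exists_eq_succ_of_ne_zero
    (letterLength_pos hgen (a := (⟨i, g⟩ : Σ i, G i)) hg).ne'
  have hfin : {x : G i | freeProductLength S (CoprodI.of x) = m + 1}.Finite :=
    (finite_letterLength_le hfinite hgen i (m + 1)).subset fun x hx => le_of_eq hx
  have hcount : 1 ≤ sphereCount S i (m + 1) := (Set.ncard_pos hfin).2 ⟨g, hm⟩
  exact ⟨m, Nat.one_le_cast.2 hcount⟩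

theorem exists_coverNumber_le_rpow [Fintype ι] (hfinite : ∀ i, (S i).Finite)
    (hgen : ∀ i, Subgroup.closure (S i) = ⊤) {α : ℝ} (hα₀ : 0 < α) (hα₁ : α < 1) {δ : ℝ}
    (hδ : 0 ≤ δ) (hs : ∀ i, Summable fun m => sphereCoeff S i m * (α ^ δ) ^ (m + 1))
    (hlt : ratioSum (seriesSum (sphereCoeff S) (α ^ δ)) < 1) (A : Set (FreeProductEnds S)) :
    ∃ K : ℝ, 0 < K ∧ ∀ ε ∈ Set.Ioo (0 : ℝ) 1,
      (coverNumber (endDist α) A ε : ℝ≥0∞) ≤ ENNReal.ofReal (K * ε ^ (-δ)) := by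
  have hz : 0 < α ^ δ := Real.rpow_pos_of_pos hα₀ δ
  obtain ⟨K, hK, hsphere⟩ := exists_encard_sphere_le hfinite hgen hz hs hlt
  refine ⟨K * (α ^ δ)⁻¹, by positivity, fun ε ⟨hε₀, hε₁⟩ => ?_⟩
  obtain ⟨m, hmε, hεm⟩ := exists_nat_pow_near_of_lt_one hε₀ hε₁.le hα₀ hα₁
  have hcover : coverNumber (endDist α) A ε ≤
      {x : CoprodI G | freeProductLength S x = m + 1}.encard :=
    (coverNumber_antitone hmε.le).trans <| coverNumber_endDist_pow_le hα₀ hα₁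
      (freeProductGraph_connected hgen) (finite_ballBelow_freeProductGraph hfinite hgen (m + 2)) A
  have hpow : ((α ^ δ) ^ m)⁻¹ ≤ ε ^ (-δ) := by
    rw [Real.rpow_neg hε₀.le, Real.rpow_pow_comm hα₀.le]
    exact inv_anti₀ (Real.rpow_pos_of_pos hε₀ δ) (Real.rpow_le_rpow hε₀.le hεm hδ)
  refine (ENat.toENNReal_mono hcover).trans <| (hsphere (m + 1)).trans <|
    ENNReal.ofReal_le_ofReal ?_
  calc K * ((α ^ δ) ^ (m + 1))⁻¹ = K * (α ^ δ)⁻¹ * ((α ^ δ) ^ m)⁻¹ := by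
        rw [pow_succ, mul_inv]; ring
    _ ≤ K * (α ^ δ)⁻¹ * ε ^ (-δ) := mul_le_mul_of_nonneg_left hpow (by positivity)

variable [Fintype ι] [Nontrivial ι] [∀ i, Nontrivial (G i)]

theorem exists_le_hausdorffContent (hfinite : ∀ i, (S i).Finite)
    (hgen : ∀ i, Subgroup.closure (S i) = ⊤) {α : ℝ} (hα₀ : 0 < α) (hα₁ : α < 1) {z : ℝ}
    (hz : IsGreatest (subcriticalSet (sphereCoeff S)) z) {δ : ℝ} (hδ : 0 ≤ δ)
    (hzδ : δ = 0 ∨ z < α ^ δ) {A : Set (FreeProductEnds S)} (hA : infiniteWordEnds S ⊆ A) :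
    ∃ c : ℝ, 0 < c ∧ ENNReal.ofReal c ≤ hausdorffContent (endDist α) A δ 1 := by
  obtain ⟨N, hN⟩ : ∃ N, 1 ≤ ratioSum (partialSum (sphereCoeff S) N (α ^ δ)) := by
    rcases hzδ with rfl | hlt
    · rw [Real.rpow_zero]
      exact exists_one_le_ratioSum_partialSum_one sphereCoeff_nonneg
        fun i => exists_one_le_sphereCoeff hfinite hgen i
    · exact (exists_one_lt_ratioSum_partialSum hz hlt).imp fun _ => le_of_lt
  exact ⟨_, pow_pos (Real.rpow_pos_of_pos hα₀ δ) N,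
    le_hausdorffContent_of_one_le_ratioSum hfinite hgen hα₀ hα₁ hδ hN hA⟩

theorem hasBoxDim_and_hausdorffDim_eq (hfinite : ∀ i, (S i).Finite)
    (hgen : ∀ i, Subgroup.closure (S i) = ⊤) {α : ℝ} (hα₀ : 0 < α) (hα₁ : α < 1) {z : ℝ}
    (hz : IsGreatest (subcriticalSet (sphereCoeff S)) z) (hz₀ : 0 < z)
    {A : Set (FreeProductEnds S)} (hA : infiniteWordEnds S ⊆ A) :
    HasBoxDim (endDist α) A ((Real.log z / Real.log α : ℝ) : EReal) ∧
      hausdorffDim (endDist α) A = ((Real.log z / Real.log α : ℝ) : EReal) := by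
  have hone := fun i => exists_one_le_sphereCoeff hfinite hgen i
  have hpos : ∀ i, ∃ m, 0 < sphereCoeff S i m := fun i =>
    (hone i).imp fun _ => one_pos.trans_le
  have hz₁ : z ≤ 1 := (subcriticalSet_subset_Icc sphereCoeff_nonneg hone hz.1).2
  set D := Real.log z / Real.log α with hD
  have hD₀ : 0 ≤ D :=
    div_nonneg_of_nonpos (Real.log_nonpos hz₀.le hz₁) (Real.log_neg hα₀ hα₁).le
  have hαD : α ^ D = z := by rw [hD, Real.log_div_log, Real.rpow_logb hα₀ hα₁.ne hz₀]
  refine hasBoxDim_and_hausdorffDim_eq_of_bounds hD₀ (fun δ hδ => ?_) fun δ hδ₀ hδ =>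
    exists_le_hausdorffContent hfinite hgen hα₀ hα₁ hz hδ₀ (hδ.imp_right fun hlt => ?_) hA
  · have hlt : α ^ δ < z := hαD ▸ Real.rpow_lt_rpow_of_exponent_gt hα₀ hα₁ hδ
    have hα : 0 ≤ α ^ δ := Real.rpow_nonneg hα₀.le δ
    exact exists_coverNumber_le_rpow hfinite hgen hα₀ hα₁ (hD₀.trans hδ.le)
      (fun i => summable_pow_of_le (sphereCoeff_nonneg i) hα hlt.le
        (summable_of_mem_subcriticalSet sphereCoeff_nonneg hpos hz.1 i))
      (ratioSum_seriesSum_lt_one sphereCoeff_nonneg hpos hz.1 hα hlt) A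
  · exact hαD ▸ Real.rpow_lt_rpow_of_exponent_gt hα₀ hα₁ hlt

theorem isLeast_sphereRoots (hfinite : ∀ i, (S i).Finite)
    (hgen : ∀ i, Subgroup.closure (S i) = ⊤) {z : ℝ}
    (hz : IsGreatest (subcriticalSet (sphereCoeff S)) z) : IsLeast (sphereRoots S) z := by
  have hpos : ∀ i, ∃ m, 0 < sphereCoeff S i m := fun i =>
    (exists_one_le_sphereCoeff hfinite hgen i).imp fun _ => one_pos.trans_le
  have hroot : ratioSum (seriesSum (sphereCoeff S) z) = 1 :=
    ratioSum_seriesSum_eq_one sphereCoeff_nonneg hpos (fun i _ =>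
      exists_gt_summable_of_submultiplicative (c := fun m => (sphereCount S i m : ℝ))
        (fun _ => Nat.cast_nonneg _)
        fun m n => by exact_mod_cast sphereCount_add_le hfinite hgen i m n) hz
  have hz₀ : z ≠ 0 := by
    rintro rfl
    simp [ratioSum, seriesSum] at hroot
  refine ⟨⟨hz.1.1.lt_of_ne' hz₀, summable_of_mem_subcriticalSet sphereCoeff_nonneg hpos hz.1,
    hroot⟩, fun y hy => ?_⟩
  by_contra! hlt
  exact (ratioSum_seriesSum_lt_one sphereCoeff_nonneg hpos hz.1 hy.1.le hlt).ne hy.2.2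

end Dimensions

theorem theorem3p5_general {ι : Type*} [Fintype ι] [Nontrivial ι] {G : ι → Type*}
    [∀ i, Group (G i)] [∀ i, Nontrivial (G i)] (S : ∀ i, Set (G i))
    (hfinite : ∀ i, (S i).Finite) (hgen : ∀ i, Subgroup.closure (S i) = ⊤)
    (α : ℝ) (hα₀ : 0 < α) (hα₁ : α < 1) :
    ∃ z : ℝ, IsLeast (sphereRoots S) z ∧
      ∀ A : Set (FreeProductEnds S), infiniteWordEnds S ⊆ A →
        HasBoxDim (endDist α) A ((Real.log z / Real.log α : ℝ) : EReal) ∧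
        hausdorffDim (endDist α) A = ((Real.log z / Real.log α : ℝ) : EReal) := by
  obtain ⟨z, hz⟩ := exists_isGreatest_subcriticalSet sphereCoeff_nonneg
    fun i => exists_one_le_sphereCoeff hfinite hgen i
  have hleast : IsLeast (sphereRoots S) z := isLeast_sphereRoots hfinite hgen hz
  exact ⟨z, hleast, fun A hA =>
    hasBoxDim_and_hausdorffDim_eq hfinite hgen hα₀ hα₁ hz hleast.1.1 hA⟩

theorem theorem3p5 {ι : Type*} [Fintype ι] {G : ι → Type*} [∀ i, Group (G i)]
    (S : ∀ i, Set (G i))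
    (hfinite : ∀ i, (S i).Finite)
    (hsymm : ∀ i, ∀ s ∈ S i, s⁻¹ ∈ S i)
    (hgen : ∀ i, Subgroup.closure (S i) = ⊤)
    (hnontrivial : ∀ i, Nontrivial (G i))
    (hcard : 2 ≤ Fintype.card ι)
    (hexclude : ¬ (Fintype.card ι = 2 ∧ ∀ i, Nat.card (G i) = 2))
    (α : ℝ) (hα₀ : 0 < α) (hα₁ : α < 1) :
    ∃ z : ℝ, IsLeast (sphereRoots S) z ∧
      HasBoxDim (endDist α) (Set.univ : Set (FreeProductEnds S))
        ((Real.log z / Real.log α : ℝ) : EReal) ∧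
      HasBoxDim (endDist α) (infiniteWordEnds S) ((Real.log z / Real.log α : ℝ) : EReal) ∧
      hausdorffDim (endDist α) (Set.univ : Set (FreeProductEnds S)) =
        ((Real.log z / Real.log α : ℝ) : EReal) ∧
      hausdorffDim (endDist α) (infiniteWordEnds S) =
        ((Real.log z / Real.log α : ℝ) : EReal) := by
  have : Nontrivial ι := Fintype.one_lt_card_iff_nontrivial.1 hcard
  obtain ⟨z, hz, h⟩ := theorem3p5_general S hfinite hgen α hα₀ hα₁
  exact ⟨z, hz, (h _ (Set.subset_univ _)).1, (h _ subset_rfl).1, (h _ (Set.subset_univ _)).2,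
    (h _ subset_rfl).2⟩
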